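/- Let $n\ge 1$, $1<p<\infty$ and $0<\gamma<1$. For $x\in\mathbb R^n$, $t\in\mathbb R$, $L>0$ put $Q(x,L)=\{y\in\mathbb R^n: |y_i-x_i|\le L,\ i=1,\dots,n\}$; the parabolic rectangle $R=R(x,t,L)=Q(x,L)\times(t-L^p,t+L^p)\subset\mathbb R^{n+1}$ has upper and lower parts $$R^+(\gamma)=Q(x,L)\times(t+\gamma L^p,\,t+L^p),\qquad R^-(\gamma)=Q(x,L)\times(t-L^p,\,t-\gamma L^p).$$ Let $w$ be a weight, that is, a nonnegative locally integrable function on $\mathbb R^{n+1}$. Write $|E|$ for Lebesgue measure, $w(E)=\int_E w$, $w_A=\frac1{|A|}\int_A w$ and $a^-=\max\{-a,0\}$. For $1<q<\infty$, $w\in A_q^+(\gamma)$ means $$\sup_{R}\Bigl(\frac1{|R^-(\gamma)|}\int_{R^-(\gamma)}w\Bigr)\Bigl(\frac1{|R^+(\gamma)|}\int_{R^+(\gamma)}w^{\frac1{1-q}}\Bigr)^{q-1}<\infty ,$$ the supremum being over all parabolic rectangles $R$, with the conventions $0^{\frac1{1-q}}=\infty$ and $0\cdot\infty=0$. Then the following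 conditions are equivalent. (i) $w\in A_q^+(\gamma)$ for some $1<q<\infty$. (ii) There exist constants $K,\delta>0$ such that $$\frac{|E|}{|R^+(\gamma)|}\le K\Bigl(\frac{w(E)}{w(R^-(\gamma))}\Bigr)^{\delta}$$ for every parabolic rectangle $R$ with $w(R^-(\gamma))>0$ and every measurable set $E\subset R^+(\gamma)$. (iii) For every $0<\alpha<1$ there exists $0<\beta<1$ such that for every parabolic rectangle $R$ and every measurable set $E\subset R^+(\gamma)$ with $w(E)<\beta\,w(R^-(\gamma))$ we have $|E|<\alpha|R^+(\gamma)|$. (iv) There exist $0<\alpha,\beta<1$ such that for every parabolic rectangle $R$ and every measurable set $E\subset R^+(\gamma)$ with $w(E)<\beta\,w(R^-(\gamma))$ we have $|E|<\alpha|R^+(\gamma)|$. (v) There exist $0<\alpha,\beta<1$ such that for every parabolic rectangle $R$ we have $$\bigl|R^+(\gamma)\cap\{w<\beta\,w_{R^-(\gamma)}\}\bigr|<\alpha|R^+(\gamma)|.$$ (vi) There exists $0<\varepsilon<1$ such that for every parabolic rectangle $R$ we have $$\frac1{|R^+(\gamma)|}\int_{R^+(\gamma)}\bigl(w-w_{R^-(\gamma)}\bigr)^-\le\varepsilon\,w_{R^-(\gamma)}.$$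 -/

import Mathlib

open MeasureTheory Set
open scoped ENNReal

/-- The data of a parabolic rectangle in `ℝⁿ × ℝ`: the centre `(x, t)` and the side length
`L > 0`. -/
structure ParabolicRectangle (n : ℕ) where
  x : Fin n → ℝ
  t : ℝ
  L : ℝ
  L_pos : 0 < L

/-- The closed cube `Q(x, L) = {y : |y i - x i| ≤ L for all i}` in `ℝⁿ`. -/
def cube {n : ℕ} (x : Fin n → ℝ) (L : ℝ) : Set (Fin n → ℝ) :=
  {y | ∀ i, |y i - x i| ≤ L}

namespace ParabolicRectangle

/-- The upper part `R⁺(γ) = Q(x, L) × (t + γ L^p, t + L^p)`. -/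
def upper {n : ℕ} (p γ : ℝ) (R : ParabolicRectangle n) : Set ((Fin n → ℝ) × ℝ) :=
  cube R.x R.L ×ˢ Ioo (R.t + γ * R.L ^ p) (R.t + R.L ^ p)

/-- The lower part `R⁻(γ) = Q(x, L) × (t - L^p, t - γ L^p)`. -/
def lower {n : ℕ} (p γ : ℝ) (R : ParabolicRectangle n) : Set ((Fin n → ℝ) × ℝ) :=
  cube R.x R.L ×ˢ Ioo (R.t - R.L ^ p) (R.t - γ * R.L ^ p)

end ParabolicRectangle

/-- A weight: a nonnegative locally integrable function on `ℝⁿ × ℝ`. -/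
structure IsWeight {n : ℕ} (w : (Fin n → ℝ) × ℝ → ℝ) : Prop where
  nonneg : ∀ z, 0 ≤ w z
  locallyIntegrable : LocallyIntegrable w volume

/-- The measure `w(E) = ∫_E w`, with values in `[0, ∞]`. -/
noncomputable def weightMeasure {n : ℕ} (w : (Fin n → ℝ) × ℝ → ℝ) :
    Measure ((Fin n → ℝ) × ℝ) :=
  volume.withDensity (fun z => ENNReal.ofReal (w z))

/-- The Muckenhoupt constant: the supremum over all parabolic rectangles `R` of
`(⨍_{R⁻(γ)} w) (⨍_{R⁺(γ)} w^{1/(1-q)})^{q-1}`, computed in `[0, ∞]`; here a negative power of `0`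
is `∞`, and `0 * ∞ = 0`. -/
noncomputable def muckenhouptConst {n : ℕ} (p γ q : ℝ) (w : (Fin n → ℝ) × ℝ → ℝ) : ℝ≥0∞ :=
  ⨆ R : ParabolicRectangle n,
    (⨍⁻ z in R.lower p γ, ENNReal.ofReal (w z) ∂volume) *
      (⨍⁻ z in R.upper p γ, ENNReal.ofReal (w z) ^ (1 / (1 - q)) ∂volume) ^ (q - 1)

/-- The parabolic Muckenhoupt class `A_q⁺(γ)`, `1 < q < ∞`. -/
def MemMuckenhoupt {n : ℕ} (p γ q : ℝ) (w : (Fin n → ℝ) × ℝ → ℝ) : Prop :=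
  IsWeight w ∧ muckenhouptConst p γ q w < ∞

/-! The substance is that (v) implies (i). The rest is soft: Hölder's inequality gives (ii) with
exponent `1 / q`, a small β turns (ii) into (iii), testing on sublevel sets gives (v), and (v) and
(vi) are exchanged by splitting the integral of the negative part at a level and by Chebyshev.

Read contrapositively, (v) says that information flows into the past: if `w ≤ s` on all but a small
fraction of a window, then the average over the window shifted back in time is at most a multiple of
`s` (`PastControl`). By Chebyshev `w` is then at most a larger multiple of `s` on most of that
earlier window, and this survives a small sideways shift, so the step can be iterated. A chain of
windows of size `r` drifts sideways by about `r` while descending by about `r ^ p`. Since `p > 1`,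
windows much smaller than a given cell can cross it sideways within a fraction of its height. The
result is a one-sided Harnack estimate (`ParabolicGrid.exists_past_cell_bound`): smallness on most
of a dyadic cell bounds the averages over all nearby cells in its past.

Next, sublevel sets at levels `e ^ k * A`, with `A` the average over the lower part, decay
geometrically (`PastBound.volume_sublevel_succ_le`). Take the first dyadic cells in which such a set
is dense, and their parents. Parents are not dense, so the set fills only a fraction of their union.
That union is in turn hardly larger than the union of long stacks of cells below the parents
(`volume_iUnion_le_stack`), and most of these stacks lies in the preceding sublevel set by the
Harnack estimate. The loss at the bottom of the rectangle is a layer of thickness `O(2 ^ (-k))`,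
because coarse cells cannot be dense.

Summing over the levels makes a small negative power `w ^ (-σ)` integrable with the right bound
(`exists_lintegral_rpow_neg_le`), which is the Muckenhoupt condition for `q = 1 + 1 / σ`. -/

/-! ### Nested countable partitions -/

/-- A sequence of countable measurable partitions of `X`, each refining the previous one; the cells
of the `k`-th partition are the fibres of `π k`. -/
structure IsNestedPartition {X ι : Type*} [MeasurableSpace X] (π : ℕ → X → ι) : Prop where
  measurableSet_fiber : ∀ k i, MeasurableSet (π k ⁻¹' {i})
  eq_of_succ : ∀ k z z', π (k + 1) z = π (k + 1) z' → π k z = π k z'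

namespace IsNestedPartition

variable {X ι : Type*} [MeasurableSpace X] {π : ℕ → X → ι}

theorem eq_of_le (h : IsNestedPartition π) {j k : ℕ} (hjk : j ≤ k) {z z' : X}
    (hz : π k z = π k z') : π j z = π j z' := by
  induction k, hjk using Nat.le_induction with
  | base => exact hz
  | succ k _ ih => exact ih (h.eq_of_succ k z z' hz)

theorem measurableSet_preimage [Countable ι] (h : IsNestedPartition π) (k : ℕ) (S : Set ι) :
    MeasurableSet (π k ⁻¹' S) := by
  have : π k ⁻¹' S = ⋃ i ∈ S, π k ⁻¹' {i} := by ext z; simp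
  rw [this]
  exact MeasurableSet.biUnion S.to_countable fun i _ => h.measurableSet_fiber k i

theorem measurableSet_iUnion [Countable ι] (h : IsNestedPartition π) (S : ℕ → Set ι) :
    MeasurableSet (⋃ k, π k ⁻¹' S k) :=
  MeasurableSet.iUnion fun k => h.measurableSet_preimage k (S k)

/-- A comparison of two measures on all cells of a family passes to the union of the family. -/
theorem measure_iUnion_le [Countable ι] (h : IsNestedPartition π) {μ ν : Measure X} {c : ℝ≥0∞}
    (S : ℕ → Set ι) (hS : ∀ k, ∀ i ∈ S k, μ (π k ⁻¹' {i}) ≤ c * ν (π k ⁻¹' {i})) :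
    μ (⋃ k, π k ⁻¹' S k) ≤ c * ν (⋃ k, π k ⁻¹' S k) := by
  classical
  -- The maximal cells of the family. Nestedness makes them pairwise disjoint, and each point of the
  -- union lies in the one given by the first generation that selects it.
  set T : Set (ℕ × ι) := {q | q.2 ∈ S q.1 ∧ ∃ z, π q.1 z = q.2 ∧ ∀ j < q.1, π j z ∉ S j} with hT
  have hU : (⋃ k, π k ⁻¹' S k) = ⋃ q ∈ T, π q.1 ⁻¹' {q.2} := by
    ext z
    simp only [mem_iUnion, mem_preimage, mem_singleton_iff, exists_prop]
    constructor
    · intro hz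
      exact ⟨(Nat.find hz, π (Nat.find hz) z),
        ⟨Nat.find_spec hz, z, rfl, fun j hj => Nat.find_min hz hj⟩, rfl⟩
    · rintro ⟨q, hq, hz⟩
      exact ⟨q.1, hz ▸ hq.1⟩
  have key : ∀ q ∈ T, ∀ q' ∈ T, ∀ z, π q.1 z = q.2 → π q'.1 z = q'.2 → ¬ q.1 < q'.1 := by
    rintro q hq q' ⟨_, z', hz', hmin⟩ z hz hz2 hlt
    refine hmin q.1 hlt ?_
    rw [h.eq_of_le hlt.le (hz'.trans hz2.symm), hz]
    exact hq.1
  have hdisj : T.PairwiseDisjoint fun q => π q.1 ⁻¹' {q.2} := by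
    intro q hq q' hq' hne
    refine Set.disjoint_left.2 fun z hz hz' => hne ?_
    have h1 : q.1 = q'.1 := le_antisymm (not_lt.1 (key q' hq' q hq z hz' hz))
      (not_lt.1 (key q hq q' hq' z hz hz'))
    refine Prod.ext h1 ?_
    rw [← (hz : π q.1 z = q.2), ← (hz' : π q'.1 z = q'.2), h1]
  have hm : ∀ q ∈ T, MeasurableSet (π q.1 ⁻¹' {q.2}) := fun q _ => h.measurableSet_fiber _ _
  rw [hU, measure_biUnion T.to_countable hdisj hm, measure_biUnion T.to_countable hdisj hm,
    ← ENNReal.tsum_mul_left]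
  exact ENNReal.tsum_le_tsum fun q => hS _ _ q.2.1

/-- If the cells shrink to points, almost every point of a set of finite measure lies in a cell in
which the set has density at least `c`, for any `c < 1`. -/
theorem ae_exists_density [Countable ι] [TopologicalSpace X] [BorelSpace X]
    (h : IsNestedPartition π) (hshrink : ∀ z : X, ∀ O, IsOpen O → z ∈ O →
      ∃ k, π k ⁻¹' {π k z} ⊆ O)
    {μ : Measure X} [μ.OuterRegular] {E : Set X} (hfin : μ E ≠ ∞)
    {c : ℝ≥0∞} (hc : c < 1) :
    μ (E \ ⋃ k, π k ⁻¹' {i | c * μ (π k ⁻¹' {i}) ≤ μ (π k ⁻¹' {i} ∩ E)}) = 0 := by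
  set N := E \ ⋃ k, π k ⁻¹' {i | c * μ (π k ⁻¹' {i}) ≤ μ (π k ⁻¹' {i} ∩ E)} with hN
  have hNfin : μ N ≠ ∞ := ne_top_of_le_ne_top hfin (measure_mono sdiff_subset)
  -- Inside any open `O ⊇ N`, the cells meeting `N` have density below `c` and cover `N`. Outer
  -- regularity then gives `μ N ≤ c * μ N`, which forces `μ N = 0`.
  have hbound : ∀ O, IsOpen O → N ⊆ O → μ N ≤ c * μ O := by
    intro O hO hNO
    set S : ℕ → Set ι := fun k => {i | π k ⁻¹' {i} ⊆ O ∧ (π k ⁻¹' {i} ∩ N).Nonempty} with hS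
    have h1 : N ⊆ ⋃ k, π k ⁻¹' S k := by
      intro z hz
      obtain ⟨k, hk⟩ := hshrink z O hO (hNO hz)
      exact mem_iUnion.2 ⟨k, hk, z, rfl, hz⟩
    have h2 : (⋃ k, π k ⁻¹' S k) ⊆ O := by
      refine iUnion_subset fun k z hz => ?_
      exact (hz : π k z ∈ S k).1 rfl
    have h3 := h.measure_iUnion_le (μ := μ.restrict E) (ν := μ) (c := c) S (by
      rintro k i ⟨-, z, hz, hzN⟩
      rw [Measure.restrict_apply (h.measurableSet_fiber k i)]
      by_contra hcon
      refine hzN.2 (mem_iUnion.2 ⟨k, ?_⟩)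
      have : π k z = i := hz
      simp only [mem_preimage, mem_ofPred_eq, this]
      exact (not_le.1 hcon).le)
    rw [Measure.restrict_apply (h.measurableSet_iUnion S)] at h3
    calc μ N ≤ μ ((⋃ k, π k ⁻¹' S k) ∩ E) := measure_mono fun z hz => ⟨h1 hz, hz.1⟩
      _ ≤ _ := h3
      _ ≤ c * μ O := by gcongr
  have hle : μ N ≤ c * μ N := by
    have hc' : c ≠ ∞ := (hc.trans ENNReal.one_lt_top).ne
    refine ENNReal.le_of_forall_pos_le_add fun ε hε _ => ?_
    obtain ⟨O, hNO, hO, hlt⟩ := Set.exists_isOpen_lt_add N hNfin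
      (ε := ε) (by exact_mod_cast hε.ne')
    calc μ N ≤ c * μ O := hbound O hO hNO
      _ ≤ c * (μ N + ε) := by gcongr
      _ = c * μ N + c * ε := mul_add _ _ _
      _ ≤ c * μ N + 1 * ε := by gcongr
      _ = _ := by rw [one_mul]
  by_contra h0
  have := ENNReal.mul_lt_mul_left (a := μ N) h0 hNfin hc
  rw [one_mul] at this
  exact absurd hle (not_le.2 this)

end IsNestedPartition

/-! ### One-sided enlargement of intervals -/

/-- For disjoint intervals this is additivity. Two overlapping intervals may be replaced by their
hull: the union is unchanged, the enlarged hull contains both enlarged intervals, and the family has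
become smaller. -/
theorem volume_biUnion_finset_Ico_extend_le {θ : ℝ} (hθ : 0 ≤ θ) (F : Finset (ℝ × ℝ))
    (hF : ∀ q ∈ F, q.1 ≤ q.2) :
    volume (⋃ q ∈ F, Ico q.1 (q.2 + θ * (q.2 - q.1))) ≤
      ENNReal.ofReal (1 + θ) * volume (⋃ q ∈ F, Ico q.1 q.2) := by
  classical
  induction hN : F.card using Nat.strong_induction_on generalizing F with
  | _ N ih =>
  by_cases hd : (F : Set (ℝ × ℝ)).PairwiseDisjoint fun q => Ico q.1 q.2
  · rw [measure_biUnion_finset hd fun q _ => measurableSet_Ico, Finset.mul_sum]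
    refine (measure_biUnion_finset_le _ _).trans (Finset.sum_le_sum fun q hq => ?_)
    rw [Real.volume_Ico, Real.volume_Ico, ← ENNReal.ofReal_mul (by positivity)]
    exact le_of_eq (by ring_nf)
  · simp only [Set.PairwiseDisjoint, Set.Pairwise, not_forall] at hd
    obtain ⟨q, hq, q', hq', hne, hdis⟩ := hd
    obtain ⟨x, hx, hx'⟩ := Set.not_disjoint_iff.1 hdis
    simp only [mem_Ico] at hx hx'
    set m : ℝ × ℝ := (min q.1 q'.1, max q.2 q'.2) with hm
    set G := insert m ((F.erase q).erase q') with hG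
    have hcard : G.card < N := by
      have h1 := Finset.card_insert_le m ((F.erase q).erase q')
      have h2 := Finset.card_erase_of_mem hq
      have h3 := Finset.card_erase_of_mem (Finset.mem_erase.2 ⟨hne.symm, hq'⟩)
      have h4 := Finset.one_lt_card.2 ⟨q, hq, q', hq', hne⟩
      change G.card ≤ _ at h1
      omega
    have hGle : ∀ r ∈ G, r.1 ≤ r.2 := by
      intro r hr
      rcases Finset.mem_insert.1 hr with rfl | hr
      · exact (min_le_left _ _).trans ((hF q hq).trans (le_max_left _ _))
      · exact hF r (Finset.mem_of_mem_erase (Finset.mem_of_mem_erase hr))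
    have hmem : ∀ r ∈ F, ∃ r' ∈ G, r'.1 ≤ r.1 ∧ r.2 ≤ r'.2 := by
      intro r hr
      by_cases h1 : r = q
      · exact ⟨m, Finset.mem_insert_self _ _, by simp [hm, h1], by simp [hm, h1]⟩
      by_cases h2 : r = q'
      · exact ⟨m, Finset.mem_insert_self _ _, by simp [hm, h2], by simp [hm, h2]⟩
      · exact ⟨r, Finset.mem_insert_of_mem
          (Finset.mem_erase.2 ⟨h2, Finset.mem_erase.2 ⟨h1, hr⟩⟩), le_rfl, le_rfl⟩
    calc volume (⋃ q ∈ F, Ico q.1 (q.2 + θ * (q.2 - q.1)))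
        ≤ volume (⋃ q ∈ G, Ico q.1 (q.2 + θ * (q.2 - q.1))) := by
          refine measure_mono (iUnion₂_subset fun r hr y hy => ?_)
          obtain ⟨r', hr', h1, h2⟩ := hmem r hr
          refine mem_iUnion₂.2 ⟨r', hr', h1.trans hy.1, hy.2.trans_le ?_⟩
          gcongr
      _ ≤ ENNReal.ofReal (1 + θ) * volume (⋃ q ∈ G, Ico q.1 q.2) := ih _ hcard G hGle rfl
      _ ≤ _ := by
          gcongr 1
          refine measure_mono (iUnion₂_subset fun r hr y hy => ?_)
          rcases Finset.mem_insert.1 hr with rfl | hr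
          · have hy1 : min q.1 q'.1 ≤ y := hy.1
            have hy2 : y < max q.2 q'.2 := hy.2
            have : y ∈ Ico q.1 q.2 ∨ y ∈ Ico q'.1 q'.2 := by
              simp only [mem_Ico]
              rcases min_le_iff.1 hy1 with h1 | h1 <;> rcases lt_max_iff.1 hy2 with h2 | h2 <;>
                rcases lt_or_ge y x with h3 | h3 <;> first
                  | exact Or.inl ⟨by linarith, by linarith⟩
                  | exact Or.inr ⟨by linarith, by linarith⟩
            rcases this with h | h
            · exact mem_iUnion₂.2 ⟨q, hq, h⟩
            · exact mem_iUnion₂.2 ⟨q', hq', h⟩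
          · exact mem_iUnion₂.2
              ⟨r, Finset.mem_of_mem_erase (Finset.mem_of_mem_erase hr), hy⟩

/-- Enlarging each interval of a countable family to the right by the fraction `θ` of its length
enlarges the measure of the union by at most the factor `1 + θ`. -/
theorem volume_biUnion_Ico_extend_le {θ : ℝ} (hθ : 0 ≤ θ) {F : Set (ℝ × ℝ)}
    (hc : F.Countable) (hF : ∀ q ∈ F, q.1 ≤ q.2) :
    volume (⋃ q ∈ F, Ico q.1 (q.2 + θ * (q.2 - q.1))) ≤
      ENNReal.ofReal (1 + θ) * volume (⋃ q ∈ F, Ico q.1 q.2) := by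
  classical
  have : Countable F := hc
  have hdir : Directed (· ⊆ ·) fun s : Finset F =>
      ⋃ q ∈ s, Ico q.1.1 (q.1.2 + θ * (q.1.2 - q.1.1)) := by
    refine Monotone.directed_le fun s t hst => ?_
    exact biUnion_subset_biUnion_left hst
  have hU : (⋃ q ∈ F, Ico q.1 (q.2 + θ * (q.2 - q.1))) =
      ⋃ s : Finset F, ⋃ q ∈ s, Ico q.1.1 (q.1.2 + θ * (q.1.2 - q.1.1)) := by
    rw [biUnion_eq_iUnion, iUnion_eq_iUnion_finset]
  rw [hU, hdir.measure_iUnion]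
  refine iSup_le fun s => ?_
  have h := volume_biUnion_finset_Ico_extend_le hθ (s.image Subtype.val) (by
    intro q hq
    obtain ⟨r, -, rfl⟩ := Finset.mem_image.1 hq
    exact hF _ r.2)
  simp only [Finset.set_biUnion_finset_image] at h
  refine h.trans ?_
  gcongr
  exact iUnion₂_subset fun r _ => subset_biUnion_of_mem (u := fun q : ℝ × ℝ => Ico q.1 q.2) r.2

/-! ### Parabolic dyadic grids -/

/-- A dyadic grid in `ℝⁿ × ℝ`: the cells of generation `k` have spatial side `side / 2 ^ k` and
height `height / 2 ^ ⌊p k⌋`. -/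
structure ParabolicGrid (n : ℕ) where
  p : ℝ
  origin : Fin n → ℝ
  side : ℝ
  height : ℝ
  one_le_p : 1 ≤ p
  side_pos : 0 < side
  height_pos : 0 < height

namespace ParabolicGrid

variable {n : ℕ} (G : ParabolicGrid n)

/-- The spatial side of the cells of generation `k`. -/
noncomputable def s (k : ℕ) : ℝ := G.side / 2 ^ k

/-- The height of the cells of generation `k`. -/
noncomputable def τ (k : ℕ) : ℝ := G.height / 2 ^ ⌊G.p * k⌋₊

/-- The index of the cell of generation `k` containing a point. -/
noncomputable def index (k : ℕ) (z : (Fin n → ℝ) × ℝ) : (Fin n → ℤ) × ℤ :=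
  (fun a => ⌊(z.1 a - G.origin a) / G.s k⌋, ⌊z.2 / G.τ k⌋)

/-- The cell of generation `k` with a given index. -/
def cell (k : ℕ) (i : (Fin n → ℤ) × ℤ) : Set ((Fin n → ℝ) × ℝ) := G.index k ⁻¹' {i}

theorem s_pos (k : ℕ) : 0 < G.s k := div_pos G.side_pos (by positivity)

theorem τ_pos (k : ℕ) : 0 < G.τ k := div_pos G.height_pos (by positivity)

theorem s_zero : G.s 0 = G.side := by simp [s]

theorem τ_zero : G.τ 0 = G.height := by simp [τ]

theorem s_succ (k : ℕ) : G.s k = 2 * G.s (k + 1) := by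
  simp only [s, pow_succ]; field_simp

theorem s_add (k q : ℕ) : G.s (k + q) = G.s k / 2 ^ q := by
  simp only [s, pow_add]; field_simp

/-- As `1 ≤ p`, the rounded exponent grows by at least one per generation. Heights therefore divide
by a power of two, which makes the grid nested, and they at least halve. -/
theorem exists_τ_succ (k : ℕ) : ∃ d : ℕ, 1 ≤ d ∧ G.τ k = 2 ^ d * G.τ (k + 1) := by
  have h : ⌊G.p * k⌋₊ + 1 ≤ ⌊G.p * (k + 1 : ℕ)⌋₊ := by
    have h0 : 0 ≤ G.p * k := mul_nonneg (zero_le_one.trans G.one_le_p) (Nat.cast_nonneg k)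
    rw [← Nat.floor_add_one h0]
    apply Nat.floor_le_floor
    push_cast
    linarith [G.one_le_p]
  refine ⟨⌊G.p * (k + 1 : ℕ)⌋₊ - ⌊G.p * k⌋₊, by omega, ?_⟩
  simp only [τ]
  rw [pow_sub₀ _ two_ne_zero (by omega)]
  field_simp

theorem two_mul_τ_succ_le (k : ℕ) : 2 * G.τ (k + 1) ≤ G.τ k := by
  obtain ⟨d, hd, h⟩ := G.exists_τ_succ k
  rw [h]
  have : (2 : ℝ) ^ 1 ≤ 2 ^ d := pow_le_pow_right₀ one_le_two hd
  nlinarith [G.τ_pos (k + 1)]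

theorem τ_le (k : ℕ) : G.τ k ≤ G.height / 2 ^ k := by
  induction k with
  | zero => simp [τ]
  | succ k ih =>
    have h := G.two_mul_τ_succ_le k
    rw [pow_succ, ← div_div, le_div_iff₀ two_pos]
    linarith

theorem s_rpow (k : ℕ) : G.s k ^ G.p = G.side ^ G.p / 2 ^ (G.p * k) := by
  rw [s, Real.div_rpow G.side_pos.le (by positivity), ← Real.rpow_natCast 2 k,
    ← Real.rpow_mul zero_le_two, mul_comm G.p]

/-- Together with `τ_le'`: rounding the exponent `p k` down costs at most a factor 2, so heights
stay comparable to the `p`-th power of the side in every generation. -/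
theorem le_τ (k : ℕ) : G.height / G.side ^ G.p * G.s k ^ G.p ≤ G.τ k := by
  have hs := Real.rpow_pos_of_pos G.side_pos G.p
  have h0 : 0 ≤ G.p * k := mul_nonneg (zero_le_one.trans G.one_le_p) (Nat.cast_nonneg k)
  have h1 : G.height / G.side ^ G.p * G.s k ^ G.p = G.height / 2 ^ (G.p * k) := by
    rw [s_rpow]; field_simp
  rw [h1, τ]
  refine div_le_div_of_nonneg_left G.height_pos.le (by positivity) ?_
  rw [← Real.rpow_natCast]
  exact Real.rpow_le_rpow_of_exponent_le one_le_two (Nat.floor_le h0)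

theorem τ_le' (k : ℕ) : G.τ k ≤ 2 * (G.height / G.side ^ G.p * G.s k ^ G.p) := by
  have hs := Real.rpow_pos_of_pos G.side_pos G.p
  have h1 : 2 * (G.height / G.side ^ G.p * G.s k ^ G.p) = G.height / (2 ^ (G.p * k) / 2) := by
    rw [s_rpow]; field_simp
  rw [h1, τ]
  refine div_le_div_of_nonneg_left G.height_pos.le (by positivity) ?_
  rw [div_le_iff₀ two_pos, ← Real.rpow_natCast, ← Real.rpow_add_one two_ne_zero]
  exact Real.rpow_le_rpow_of_exponent_le one_le_two (Nat.lt_floor_add_one _).le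

theorem τ_le_succ (k : ℕ) : G.τ k ≤ 2 * 2 ^ G.p * G.τ (k + 1) := by
  have h1 := G.τ_le' k
  have h2 := G.le_τ (k + 1)
  rw [s_succ, Real.mul_rpow zero_le_two (G.s_pos _).le] at h1
  have h3 : (0 : ℝ) < 2 ^ G.p := by positivity
  calc G.τ k ≤ _ := h1
    _ = 2 * 2 ^ G.p * (G.height / G.side ^ G.p * G.s (k + 1) ^ G.p) := by ring
    _ ≤ _ := by gcongr

theorem mem_cell {k : ℕ} {i : (Fin n → ℤ) × ℤ} {z : (Fin n → ℝ) × ℝ} :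
    z ∈ G.cell k i ↔ (∀ a, z.1 a ∈ Ico (G.origin a + i.1 a * G.s k)
      (G.origin a + (i.1 a + 1) * G.s k)) ∧ z.2 ∈ Ico (i.2 * G.τ k) ((i.2 + 1) * G.τ k) := by
  have h1 : z ∈ G.cell k i ↔ (∀ a, ⌊(z.1 a - G.origin a) / G.s k⌋ = i.1 a) ∧
      ⌊z.2 / G.τ k⌋ = i.2 := by
    simp [cell, index, Prod.ext_iff, funext_iff]
  simp only [h1, Int.floor_eq_iff, le_div_iff₀ (G.s_pos k), div_lt_iff₀ (G.s_pos k),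
    le_div_iff₀ (G.τ_pos k), div_lt_iff₀ (G.τ_pos k), mem_Ico]
  refine and_congr (forall_congr' fun a => ?_) Iff.rfl
  constructor <;> rintro ⟨h, h'⟩ <;> constructor <;> linarith

theorem cell_eq_prod (k : ℕ) (i : (Fin n → ℤ) × ℤ) :
    G.cell k i = (univ.pi fun a => Ico (G.origin a + i.1 a * G.s k)
      (G.origin a + (i.1 a + 1) * G.s k)) ×ˢ Ico (i.2 * G.τ k) ((i.2 + 1) * G.τ k) := by
  ext z
  simp only [mem_cell, mem_prod, mem_univ_pi]

theorem mem_cell_index (k : ℕ) (z : (Fin n → ℝ) × ℝ) : z ∈ G.cell k (G.index k z) := rfl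

theorem measurableSet_cell (k : ℕ) (i : (Fin n → ℤ) × ℤ) : MeasurableSet (G.cell k i) := by
  rw [cell_eq_prod]
  exact (MeasurableSet.univ_pi fun a => measurableSet_Ico).prod measurableSet_Ico

theorem volume_cell (k : ℕ) (i : (Fin n → ℤ) × ℤ) :
    volume (G.cell k i) = ENNReal.ofReal (G.s k ^ n * G.τ k) := by
  have h1 : ∀ a, G.origin a + (i.1 a + 1) * G.s k - (G.origin a + i.1 a * G.s k) = G.s k :=
    fun a => by ring
  have h2 : (i.2 + 1) * G.τ k - i.2 * G.τ k = G.τ k := by ring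
  rw [cell_eq_prod, Measure.volume_eq_prod, Measure.prod_prod, Real.volume_pi_Ico,
    Real.volume_Ico, h2]
  simp only [h1, Finset.prod_const, Finset.card_univ, Fintype.card_fin]
  rw [ENNReal.ofReal_mul (pow_nonneg (G.s_pos k).le _), ENNReal.ofReal_pow (G.s_pos k).le]

theorem volume_cell_ne_zero (k : ℕ) (i : (Fin n → ℤ) × ℤ) : volume (G.cell k i) ≠ 0 := by
  rw [volume_cell]
  exact (ENNReal.ofReal_pos.2 (mul_pos (pow_pos (G.s_pos k) _) (G.τ_pos k))).ne'

theorem volume_cell_ne_top (k : ℕ) (i : (Fin n → ℤ) × ℤ) : volume (G.cell k i) ≠ ∞ := by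
  rw [volume_cell]
  exact ENNReal.ofReal_ne_top

theorem isNestedPartition : IsNestedPartition G.index where
  measurableSet_fiber := G.measurableSet_cell
  eq_of_succ k z z' h := by
    have hs : ∀ x : ℝ, ⌊x / G.s k⌋ = ⌊x / G.s (k + 1)⌋ / (2 : ℕ) := fun x => by
      rw [← Int.floor_div_natCast, G.s_succ k]
      congr 1
      have := G.s_pos (k + 1)
      push_cast
      field_simp
    obtain ⟨d, -, hd⟩ := G.exists_τ_succ k
    have ht : ∀ x : ℝ, ⌊x / G.τ k⌋ = ⌊x / G.τ (k + 1)⌋ / (2 ^ d : ℕ) := fun x => by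
      rw [← Int.floor_div_natCast, hd]
      congr 1
      have := G.τ_pos (k + 1)
      push_cast
      field_simp
    simp only [index, Prod.mk.injEq] at h ⊢
    refine ⟨funext fun a => ?_, ?_⟩
    · rw [hs, hs, congrFun h.1 a]
    · rw [ht, ht, h.2]

theorem abs_sub_lt_of_index_eq {k : ℕ} {z z' : (Fin n → ℝ) × ℝ} (h : G.index k z = G.index k z') :
    (∀ a, |z.1 a - z'.1 a| < G.s k) ∧ |z.2 - z'.2| < G.τ k := by
  have h1 := G.mem_cell.1 (G.mem_cell_index k z)
  have h2 := G.mem_cell.1 (G.mem_cell_index k z')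
  rw [h] at h1
  simp only [mem_Ico] at h1 h2
  refine ⟨fun a => abs_lt.2 ⟨?_, ?_⟩, abs_lt.2 ⟨?_, ?_⟩⟩
  · linarith [(h1.1 a).1, (h2.1 a).2]
  · linarith [(h1.1 a).2, (h2.1 a).1]
  · linarith [h1.2.1, h2.2.2]
  · linarith [h1.2.2, h2.2.1]

theorem exists_cell_subset {z : (Fin n → ℝ) × ℝ} {O : Set ((Fin n → ℝ) × ℝ)} (hO : IsOpen O)
    (hz : z ∈ O) : ∃ k, G.cell k (G.index k z) ⊆ O := by
  obtain ⟨ε, hε, hball⟩ := Metric.isOpen_iff.1 hO z hz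
  obtain ⟨k, hk⟩ := exists_pow_lt_of_lt_one (y := (1 / 2 : ℝ))
    (div_pos hε (add_pos G.side_pos G.height_pos)) (by norm_num)
  rw [lt_div_iff₀ (add_pos G.side_pos G.height_pos)] at hk
  have hp : (0 : ℝ) < (1 / 2) ^ k := by positivity
  have h1 : G.s k = (1 / 2) ^ k * G.side := by simp [s]; ring
  have h2 : G.τ k ≤ (1 / 2) ^ k * G.height := (G.τ_le k).trans (le_of_eq (by simp; ring))
  refine ⟨k, fun y hy => hball ?_⟩
  obtain ⟨h3, h4⟩ := G.abs_sub_lt_of_index_eq (k := k) (z := y) (z' := z) hy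
  have := mul_pos hp G.side_pos
  have := mul_pos hp G.height_pos
  rw [Metric.mem_ball, Prod.dist_eq, max_lt_iff]
  refine ⟨(dist_pi_lt_iff hε).2 fun a => ?_, ?_⟩
  · rw [Real.dist_eq]; linarith [h3 a]
  · rw [Real.dist_eq]; linarith

/-- If a measure of small cells is controlled at every point of a cell, it is controlled on the
cell. -/
theorem measure_cell_le {μ : Measure ((Fin n → ℝ) × ℝ)} {c : ℝ≥0∞} {j g : ℕ} (hjg : j ≤ g)
    {i : (Fin n → ℤ) × ℤ}
    (h : ∀ z ∈ G.cell j i, μ (G.cell g (G.index g z)) ≤ c * volume (G.cell g (G.index g z))) :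
    μ (G.cell j i) ≤ c * volume (G.cell j i) := by
  set S : ℕ → Set ((Fin n → ℤ) × ℤ) := fun k => {b | k = g ∧ ∃ z ∈ G.cell j i, G.index g z = b}
  have hU : (⋃ k, G.index k ⁻¹' S k) = G.cell j i := by
    ext z
    simp only [mem_iUnion, mem_preimage, S, mem_ofPred_eq]
    constructor
    · rintro ⟨k, rfl, z', hz', he⟩
      exact (G.isNestedPartition.eq_of_le hjg he.symm).trans hz'
    · intro hz
      exact ⟨g, rfl, z, hz, rfl⟩
  rw [← hU]
  refine G.isNestedPartition.measure_iUnion_le S ?_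
  rintro k b ⟨rfl, z, hz, rfl⟩
  exact h z hz

end ParabolicGrid

/-! ### Windows and chains -/

/-- Chebyshev's inequality, arranged so that the levels `0` and `∞` are allowed. -/
theorem measure_inter_lt_le_of_withDensity_le {X : Type*} [MeasurableSpace X] {ν : Measure X}
    {f : X → ℝ≥0∞} (hf : Measurable f) {P : Set X} (hP : MeasurableSet P) {ε s : ℝ≥0∞}
    (h : ν.withDensity f P ≤ ε * s * ν P) : ν (P ∩ {z | s < f z}) ≤ ε * ν P := by
  rw [withDensity_apply _ hP] at h
  rcases eq_or_ne s 0 with rfl | hs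
  · have h0 : ∫⁻ z in P, f z ∂ν = 0 := by simpa using h
    rw [lintegral_eq_zero_iff hf] at h0
    have : ν (P ∩ {z | 0 < f z}) = 0 := by
      have h1 : ν.restrict P {z | ¬ f z = 0} = 0 := h0
      rw [Measure.restrict_apply' hP] at h1
      rw [inter_comm]
      simpa only [pos_iff_ne_zero] using h1
    rw [this]
    exact zero_le
  rcases eq_or_ne s ∞ with rfl | hs'
  · simp
  have h1 := mul_meas_ge_le_lintegral (μ := ν.restrict P) hf s
  rw [Measure.restrict_apply' hP] at h1
  have h2 : s * ν (P ∩ {z | s < f z}) ≤ s * (ε * ν P) :=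
    calc s * ν (P ∩ {z | s < f z}) ≤ s * ν ({z | s ≤ f z} ∩ P) := by
          have hsub : P ∩ {z | s < f z} ⊆ {z | s ≤ f z} ∩ P := fun z hz =>
            ⟨(show s < f z from hz.2).le, hz.1⟩
          exact mul_le_mul_right (measure_mono hsub) s
      _ ≤ ε * s * ν P := h1.trans h
      _ = _ := by ring
  exact (ENNReal.mul_le_mul_iff_right hs hs').1 h2

theorem cube_eq_closedBall {n : ℕ} (x : Fin n → ℝ) {r : ℝ} (hr : 0 ≤ r) :
    cube x r = Metric.closedBall x r := by
  ext y
  simp [cube, dist_pi_le_iff hr, Real.dist_eq]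

theorem measurableSet_cube {n : ℕ} (x : Fin n → ℝ) {r : ℝ} (hr : 0 ≤ r) :
    MeasurableSet (cube x r) := by
  rw [cube_eq_closedBall x hr]
  exact measurableSet_closedBall

theorem volume_cube {n : ℕ} (x : Fin n → ℝ) {r : ℝ} (hr : 0 ≤ r) :
    volume (cube x r) = ENNReal.ofReal ((2 * r) ^ n) := by
  rw [cube_eq_closedBall x hr, Real.volume_pi_closedBall x hr, Fintype.card_fin]

/-- Both cubes contain the cube of radius `(1 - θ / 2) r` about the midpoint of their centres;
Bernoulli's inequality bounds what is left. -/
theorem volume_cube_diff_le {n : ℕ} {x x' : Fin n → ℝ} {r θ : ℝ} (hr : 0 ≤ r) (hθ0 : 0 ≤ θ)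
    (hθ1 : θ ≤ 1) (h : ∀ a, |x' a - x a| ≤ θ * r) :
    volume (cube x' r \ cube x r) ≤ ENNReal.ofReal (n * θ) * volume (cube x' r) := by
  set r' := (1 - θ / 2) * r
  have hr' : 0 ≤ r' := mul_nonneg (by linarith) hr
  set m : Fin n → ℝ := fun a => (x a + x' a) / 2
  have hsub : cube m r' ⊆ cube x r ∩ cube x' r := by
    intro y hy
    refine ⟨fun a => ?_, fun a => ?_⟩ <;>
    · have h1 := abs_le.1 (hy a)
      have h2 := abs_le.1 (h a)
      simp only [m, r'] at h1
      exact abs_le.2 ⟨by nlinarith, by nlinarith⟩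
  calc volume (cube x' r \ cube x r) ≤ volume (cube x' r \ cube m r') :=
        measure_mono (sdiff_subset_sdiff_right fun y hy => (hsub hy).1)
    _ = volume (cube x' r) - volume (cube m r') := by
        refine measure_sdiff (fun y hy => (hsub hy).2) (measurableSet_cube m hr').nullMeasurableSet ?_
        rw [volume_cube m hr']
        exact ENNReal.ofReal_ne_top
    _ ≤ _ := by
        rw [volume_cube _ hr, volume_cube _ hr', ← ENNReal.ofReal_sub _ (by positivity),
          ← ENNReal.ofReal_mul (by positivity)]
        refine ENNReal.ofReal_le_ofReal ?_
        have hb := one_add_mul_le_pow (a := -(θ / 2)) (by linarith) n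
        have e : (2 * r') ^ n = (2 * r) ^ n * (1 + -(θ / 2)) ^ n := by
          rw [← mul_pow]; simp only [r']; ring
        rw [e]
        have hp : 0 ≤ (2 * r) ^ n := by positivity
        have hn : (0 : ℝ) ≤ n * θ := by positivity
        nlinarith [mul_le_mul_of_nonneg_left hb hp, mul_nonneg hn hp]

/-- The set `Q(x, r) × (c, c + (1 - γ) r ^ p)`, a time translate of the upper and lower parts of a
parabolic rectangle. -/
def window {n : ℕ} (p γ : ℝ) (x : Fin n → ℝ) (c r : ℝ) : Set ((Fin n → ℝ) × ℝ) :=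
  cube x r ×ˢ Ioo c (c + (1 - γ) * r ^ p)

theorem measurableSet_window {n : ℕ} (p γ : ℝ) (x : Fin n → ℝ) (c : ℝ) {r : ℝ} (hr : 0 ≤ r) :
    MeasurableSet (window p γ x c r) :=
  (measurableSet_cube x hr).prod measurableSet_Ioo

theorem volume_window {n : ℕ} (p γ : ℝ) (x : Fin n → ℝ) (c : ℝ) {r : ℝ} (hr : 0 ≤ r) :
    volume (window p γ x c r) = ENNReal.ofReal ((2 * r) ^ n * ((1 - γ) * r ^ p)) := by
  rw [window, Measure.volume_eq_prod, Measure.prod_prod, volume_cube x hr, Real.volume_Ioo,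
    add_sub_cancel_left, ← ENNReal.ofReal_mul (by positivity)]

/-- A function that is at most `s` on a large part of a window has average at most `K₀ s` over the
window shifted to the past by `(1 + γ) r ^ p`. -/
def PastControl {n : ℕ} (p γ ε₀ : ℝ) (K₀ : ℝ≥0∞) (f : (Fin n → ℝ) × ℝ → ℝ≥0∞) : Prop :=
  ∀ (x : Fin n → ℝ) (c r : ℝ), 0 < r → ∀ s : ℝ≥0∞,
    volume (window p γ x c r ∩ {z | s < f z}) ≤ ENNReal.ofReal ε₀ * volume (window p γ x c r) →
    volume.withDensity f (window p γ x (c - (1 + γ) * r ^ p) r) ≤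
      K₀ * s * volume (window p γ x c r)

/-- One link of a chain. Half of the exceptional fraction `ε₀` pays for Chebyshev in the past
window, which fixes `K`; the other half pays for the sideways shift, which fixes `θ`. -/
theorem exists_step_constants (n : ℕ) {p γ ε₀ : ℝ} {K₀ : ℝ≥0∞} (hε₀ : 0 < ε₀) (hK₀ : K₀ ≠ ∞) :
    ∃ θ : ℝ, 0 < θ ∧ θ ≤ 1 ∧ ∃ K : ℝ≥0∞, K ≠ ∞ ∧ 1 ≤ K ∧
      ∀ f : (Fin n → ℝ) × ℝ → ℝ≥0∞, Measurable f → PastControl p γ ε₀ K₀ f →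
      ∀ (x x' : Fin n → ℝ) (c r : ℝ), 0 < r → (∀ a, |x' a - x a| ≤ θ * r) → ∀ s : ℝ≥0∞,
        volume (window p γ x c r ∩ {z | s < f z}) ≤
          ENNReal.ofReal ε₀ * volume (window p γ x c r) →
        volume (window p γ x' (c - (1 + γ) * r ^ p) r ∩ {z | K * s < f z}) ≤
          ENNReal.ofReal ε₀ * volume (window p γ x' (c - (1 + γ) * r ^ p) r) := by
  have hn : (0 : ℝ) ≤ n := Nat.cast_nonneg n
  set θ : ℝ := min 1 (ε₀ / (2 * (n + 1)))
  have hθ : 0 < θ := lt_min one_pos (by positivity)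
  have hθn : n * θ ≤ ε₀ / 2 := by
    have h1 : θ ≤ ε₀ / (2 * (n + 1)) := min_le_right _ _
    rw [le_div_iff₀ (by positivity)] at h1
    nlinarith
  set e : ℝ≥0∞ := ENNReal.ofReal (ε₀ / 2) with he
  have he0 : e ≠ 0 := (ENNReal.ofReal_pos.2 (by linarith)).ne'
  refine ⟨θ, hθ, min_le_left _ _, max 1 (K₀ / e), ?_, le_max_left _ _, ?_⟩
  · exact (max_lt ENNReal.one_lt_top (ENNReal.div_lt_top hK₀ he0)).ne
  intro f hf hctl x x' c r hr hx s hs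
  set K : ℝ≥0∞ := max 1 (K₀ / e)
  set c' := c - (1 + γ) * r ^ p
  have hvol : ∀ y d, volume (window p γ y d r) = volume (window p γ x c r) := fun y d => by
    rw [volume_window _ _ _ _ hr.le, volume_window _ _ _ _ hr.le]
  have h1 : volume (window p γ x c' r ∩ {z | K * s < f z}) ≤ e * volume (window p γ x c' r) := by
    refine measure_inter_lt_le_of_withDensity_le hf (measurableSet_window p γ x c' hr.le) ?_
    rw [hvol]
    refine (hctl x c r hr s hs).trans ?_
    refine mul_le_mul_left ?_ _
    rw [← mul_assoc]
    refine mul_le_mul_left ?_ _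
    calc K₀ = e * (K₀ / e) := (ENNReal.mul_div_cancel he0 ENNReal.ofReal_ne_top).symm
      _ ≤ e * K := by gcongr; exact le_max_right _ _
  have h2 : volume (window p γ x' c' r \ window p γ x c' r) ≤
      e * volume (window p γ x' c' r) := by
    have hd : window p γ x' c' r \ window p γ x c' r =
        (cube x' r \ cube x r) ×ˢ Ioo c' (c' + (1 - γ) * r ^ p) := by
      ext z; simp only [window, mem_prod, mem_sdiff]; tauto
    rw [hd, window, Measure.volume_eq_prod, Measure.prod_prod, Measure.prod_prod, ← mul_assoc]
    refine mul_le_mul_left ?_ _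
    refine (volume_cube_diff_le hr.le hθ.le (min_le_left _ _) hx).trans ?_
    refine mul_le_mul_left ?_ _
    exact ENNReal.ofReal_le_ofReal hθn
  calc volume (window p γ x' c' r ∩ {z | K * s < f z})
      ≤ volume ((window p γ x c' r ∩ {z | K * s < f z}) ∪
          (window p γ x' c' r \ window p γ x c' r)) := by
        refine measure_mono fun z hz => ?_
        by_cases hzx : z ∈ window p γ x c' r
        · exact Or.inl ⟨hzx, hz.2⟩
        · exact Or.inr ⟨hz.1, hzx⟩
    _ ≤ e * volume (window p γ x c' r) + e * volume (window p γ x' c' r) :=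
        (measure_union_le _ _).trans (add_le_add h1 h2)
    _ = _ := by
        rw [hvol x c', hvol x' c', ← add_mul, he, ← ENNReal.ofReal_add (by linarith) (by linarith), add_halves]

/-- Iterates the single step along the segment from `x` to `x'`, divided into `M` equal pieces. -/
theorem volume_window_travel {n : ℕ} {p γ ε₀ θ : ℝ} {K : ℝ≥0∞}
    {f : (Fin n → ℝ) × ℝ → ℝ≥0∞} {r : ℝ}
    (hstep : ∀ (x x' : Fin n → ℝ) (c : ℝ), (∀ a, |x' a - x a| ≤ θ * r) → ∀ s : ℝ≥0∞,
        volume (window p γ x c r ∩ {z | s < f z}) ≤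
          ENNReal.ofReal ε₀ * volume (window p γ x c r) →
        volume (window p γ x' (c - (1 + γ) * r ^ p) r ∩ {z | K * s < f z}) ≤
          ENNReal.ofReal ε₀ * volume (window p γ x' (c - (1 + γ) * r ^ p) r))
    (M : ℕ) (x x' : Fin n → ℝ) (c : ℝ) (s : ℝ≥0∞) (hx : ∀ a, |x' a - x a| ≤ M * (θ * r))
    (h : volume (window p γ x c r ∩ {z | s < f z}) ≤
      ENNReal.ofReal ε₀ * volume (window p γ x c r)) :
    volume (window p γ x' (c - M * ((1 + γ) * r ^ p)) r ∩ {z | K ^ M * s < f z}) ≤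
      ENNReal.ofReal ε₀ * volume (window p γ x' (c - M * ((1 + γ) * r ^ p)) r) := by
  induction M generalizing x c s with
  | zero =>
    have : x' = x := funext fun a => by
      have := hx a
      rw [Nat.cast_zero, zero_mul] at this
      linarith [abs_nonpos_iff.1 this]
    simpa [this] using h
  | succ M ih =>
    have hM : (0 : ℝ) < M + 1 := by positivity
    set y : Fin n → ℝ := fun a => x a + (x' a - x a) / (M + 1)
    have h1 : ∀ a, |y a - x a| ≤ θ * r := fun a => by
      have := hx a
      push_cast at this
      simp only [y, add_sub_cancel_left]
      rwa [abs_div, abs_of_pos hM, div_le_iff₀ hM, mul_comm (θ * r)]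
    have h2 : ∀ a, |x' a - y a| ≤ M * (θ * r) := fun a => by
      have := hx a
      push_cast at this
      have e : x' a - y a = (M / (M + 1)) * (x' a - x a) := by
        simp only [y]; field_simp; ring
      rw [e, abs_mul, abs_of_nonneg (by positivity), div_mul_eq_mul_div, div_le_iff₀ hM]
      calc (M : ℝ) * |x' a - x a| ≤ M * ((M + 1) * (θ * r)) := by gcongr
        _ = _ := by ring
    have h3 := ih y (c - (1 + γ) * r ^ p) (K * s) h2 (hstep x y c h1 s h)
    have e1 : c - (1 + γ) * r ^ p - M * ((1 + γ) * r ^ p) =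
        c - ((M + 1 : ℕ) : ℝ) * ((1 + γ) * r ^ p) := by push_cast; ring
    rwa [e1, ← mul_assoc (K ^ M), ← pow_succ] at h3

/-! ### A one-sided Harnack estimate -/

/-- This is where `p > 1` enters: after refining by `2 ^ q`, the number of time steps available
exceeds the number of sideways steps needed by the factor `(2 ^ q) ^ (p - 1)`, up to constants. -/
theorem exists_two_pow_rpow_ge {p : ℝ} (hp : 1 < p) (A : ℝ) :
    ∃ q : ℕ, 4 ≤ (2 : ℝ) ^ q ∧ A ≤ ((2 : ℝ) ^ q) ^ (p - 1) := by
  have h1 : Filter.Tendsto (fun q : ℕ => ((2 : ℝ) ^ q)) Filter.atTop Filter.atTop :=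
    tendsto_pow_atTop_atTop_of_one_lt one_lt_two
  have h2 := (tendsto_rpow_atTop (sub_pos.2 hp)).comp h1
  obtain ⟨q, hq, hq'⟩ :=
    ((h1.eventually_ge_atTop 4).and (h2.eventually_ge_atTop A)).exists
  exact ⟨q, hq, hq'⟩

set_option maxHeartbeats 1000000 in
/-- A one-sided Harnack type estimate on a parabolic grid: if `f ≤ s` on most of a cell, then the
averages of `f` over the smaller cells in the past are bounded by a multiple of `s`. -/
theorem ParabolicGrid.exists_past_cell_bound (n : ℕ) {p γ ε₀ Λ : ℝ} {K₀ : ℝ≥0∞} (hp : 1 < p)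
    (hγ0 : 0 < γ) (hγ1 : γ < 1) (hε₀ : 0 < ε₀) (hK₀ : K₀ ≠ ∞) (hΛ : 0 < Λ)
    (hΛ' : Λ ≤ (1 - γ) / 4) :
    ∃ q : ℕ, ∃ ε₁ : ℝ, 0 < ε₁ ∧ ε₁ < 1 ∧ ∀ N : ℝ, 0 ≤ N → ∃ C : ℝ≥0∞, C ≠ ∞ ∧
      ∀ f : (Fin n → ℝ) × ℝ → ℝ≥0∞, Measurable f → PastControl p γ ε₀ K₀ f →
      ∀ G : ParabolicGrid n, G.p = p → G.height = Λ * G.side ^ p →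
      ∀ (k : ℕ) (z₀ : (Fin n → ℝ) × ℝ) (s : ℝ≥0∞),
        volume (G.cell k (G.index k z₀) ∩ {z | s < f z}) ≤
          ENNReal.ofReal ε₁ * volume (G.cell k (G.index k z₀)) →
        ∀ z : (Fin n → ℝ) × ℝ, (∀ a, |z.1 a - z₀.1 a| ≤ 4 * G.s k) →
          2 * G.τ k ≤ z₀.2 - z.2 → z₀.2 - z.2 ≤ N * G.τ k →
          volume.withDensity f (G.cell (k + q) (G.index (k + q) z)) ≤
            C * s * volume (G.cell (k + q) (G.index (k + q) z)) := by
  obtain ⟨θ, hθ, hθ1, K, hK, hK1, hstep⟩ :=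
    exists_step_constants n (p := p) (γ := γ) hε₀ hK₀
  obtain ⟨q, hq4, hqA⟩ := exists_two_pow_rpow_ge hp (2 / Λ * (5 / θ + 1))
  set Y : ℝ := 2 ^ q with hY
  have hY0 : 0 < Y := by positivity
  have hYp0 : 0 < Y ^ p := by positivity
  have hYp : Y ^ p = Y ^ (p - 1) * Y := by
    rw [← Real.rpow_add_one hY0.ne', sub_add_cancel]
  -- The left side counts the links needed to drift by `5 σ` at speed `θ r = θ σ / Y`; the right
  -- side bounds from below the links that fit into one cell height.
  have hYtravel : 5 / θ * Y + 1 ≤ Λ * Y ^ p / 2 := by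
    have : (5 / θ + 1) * Y ≤ Λ * Y ^ p / 2 := by
      rw [hYp]
      calc (5 / θ + 1) * Y = Λ / 2 * (2 / Λ * (5 / θ + 1)) * Y := by field_simp
        _ ≤ Λ / 2 * Y ^ (p - 1) * Y := by gcongr
        _ = _ := by ring
    linarith
  have hYtime : 1 ≤ Λ * Y ^ p / 2 := by
    have : 0 < 5 / θ * Y := by positivity
    linarith
  -- A lower bound for the share of a cell filled by a window of radius `σ / Y`, so an exceptional
  -- fraction `ε₀ * η` of the cell is at most a fraction `ε₀` of the window.
  set η : ℝ := (1 - γ) / (2 * Λ * Y ^ n * Y ^ p) with hη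
  have hη0 : 0 < η := div_pos (by linarith) (by positivity)
  refine ⟨q, min (1 / 2) (ε₀ * η), lt_min (by norm_num) (by positivity),
    (min_le_left _ _).trans_lt (by norm_num), fun N hN => ?_⟩
  set M₁ : ℕ := ⌈(N + 1) * (2 * Λ * Y ^ p)⌉₊ with hM₁
  refine ⟨K₀ * K ^ M₁ * ENNReal.ofReal (2 ^ n * ((1 - γ) / Λ)), ?_, ?_⟩
  · exact ENNReal.mul_ne_top (ENNReal.mul_ne_top hK₀ (ENNReal.pow_ne_top hK)) ENNReal.ofReal_ne_top
  intro f hf hctl G hGp hGh k z₀ s hs z hzx hzt1 hzt2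
  have hgam : 0 < 1 - γ := by linarith
  -- sizes
  set σ := G.s k with hσ
  have hσ0 : 0 < σ := G.s_pos k
  have hσp : 0 < σ ^ p := by positivity
  set r := G.s (k + q) with hr
  have hrσ : r = σ / Y := G.s_add k q
  have hr0 : 0 < r := G.s_pos _
  have hrp0 : 0 < r ^ p := by positivity
  have hrp : σ ^ p = r ^ p * Y ^ p := by
    rw [← Real.mul_rpow hr0.le hY0.le, hrσ, div_mul_cancel₀ _ hY0.ne']
  have hside : G.height / G.side ^ G.p = Λ := by
    have := Real.rpow_pos_of_pos G.side_pos p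
    rw [hGh, hGp]; field_simp
  have hτ1 : Λ * σ ^ p ≤ G.τ k := by have := G.le_τ k; rwa [hside, hGp] at this
  have hτ2 : G.τ k ≤ 2 * (Λ * σ ^ p) := by have := G.τ_le' k; rwa [hside, hGp] at this
  have hτq1 : Λ * r ^ p ≤ G.τ (k + q) := by have := G.le_τ (k + q); rwa [hside, hGp] at this
  have hτq2 : G.τ (k + q) ≤ 2 * (Λ * r ^ p) := by
    have := G.τ_le' (k + q); rwa [hside, hGp] at this
  have hτk0 := G.τ_pos k
  have hrτ : 2 * r ^ p ≤ G.τ k := by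
    have : 2 * r ^ p * 1 ≤ 2 * r ^ p * (Λ * Y ^ p / 2) := by gcongr
    have e : 2 * r ^ p * (Λ * Y ^ p / 2) = Λ * σ ^ p := by rw [hrp]; ring
    linarith only [this, e, hτ1]
  -- the cell at `z₀`
  set i := G.index k z₀ with hi
  have hz₀ := G.mem_cell.1 (G.mem_cell_index k z₀)
  rw [← hi] at hz₀
  set a : ℝ := i.2 * G.τ k with ha
  have ha1 : a ≤ z₀.2 := hz₀.2.1
  have ha2 : z₀.2 < a + G.τ k := by have := hz₀.2.2; rw [ha]; linarith
  set xP : Fin n → ℝ := fun b => G.origin b + (i.1 b + 1 / 2) * σ with hxP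
  have hxPz : ∀ b, |z₀.1 b - xP b| ≤ σ := fun b => by
    have h1 := (hz₀.1 b).1
    have h2 := (hz₀.1 b).2
    rw [abs_le, hxP]
    constructor <;> linarith
  -- the chain
  set Δ : ℝ := (1 + γ) * r ^ p with hΔ
  have hΔ0 : 0 < Δ := by positivity
  -- The final window is centred at `z` in time too; by `Λ ≤ (1 - γ) / 4` it contains the small cell
  -- of `z`.
  set c' : ℝ := z.2 - (1 - γ) * r ^ p / 2 with hc'
  have hgr : 0 < (1 - γ) * r ^ p := by positivity
  have hac1 : G.τ k ≤ a - c' := by rw [hc']; linarith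
  have hac2 : a - c' ≤ (N + 1) * G.τ k := by 
    have h1 : (1 - γ) * r ^ p ≤ r ^ p := by nlinarith only [hγ0, hrp0]
    rw [hc']; linarith only [hrτ, hrp0, ha1, hzt2, h1]
  set v : ℝ := (a - c') / Δ with hv
  have hv0 : 0 ≤ v := div_nonneg (by linarith) hΔ0.le
  have hvΔ : v * Δ = a - c' := div_mul_cancel₀ _ hΔ0.ne'
  set M : ℕ := ⌊v⌋₊ with hM
  have hMv : (M : ℝ) ≤ v := Nat.floor_le hv0
  have hvM : v < M + 1 := Nat.lt_floor_add_one v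
  -- The chain is laid out backwards from its end. The extra link is the last application of past
  -- control, which yields an average instead of a sublevel bound. Rounding puts the start within
  -- `Δ` of the bottom of the given cell.
  set cs : ℝ := c' + (M + 1) * Δ with hcs
  have hcs1 : a ≤ cs := by
    have := mul_le_mul_of_nonneg_right hvM.le hΔ0.le
    rw [hcs]; linarith only [this, hvΔ]
  have hcs2 : cs ≤ a + Δ := by
    have := mul_le_mul_of_nonneg_right hMv hΔ0.le
    rw [hcs]; linarith only [this, hvΔ]
  have hMM₁ : M ≤ M₁ := by
    refine Nat.floor_le_of_le ((?_ : v ≤ (N + 1) * (2 * Λ * Y ^ p)).trans (Nat.le_ceil _))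
    rw [hv, div_le_iff₀ hΔ0]
    have h1 : r ^ p ≤ Δ := by rw [hΔ]; nlinarith only [hγ0, hrp0]
    calc a - c' ≤ (N + 1) * G.τ k := hac2
      _ ≤ (N + 1) * (2 * (Λ * σ ^ p)) := by gcongr
      _ = (N + 1) * (2 * Λ * Y ^ p) * r ^ p := by rw [hrp]; ring
      _ ≤ _ := by gcongr
  have hMtravel : 5 * σ ≤ M * (θ * r) := by
    have h1 : Λ * Y ^ p / 2 ≤ v := by
      rw [hv, le_div_iff₀ hΔ0]
      have h2 : Δ ≤ 2 * r ^ p := by rw [hΔ]; nlinarith only [hγ1, hrp0]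
      calc Λ * Y ^ p / 2 * Δ ≤ Λ * Y ^ p / 2 * (2 * r ^ p) := by gcongr
        _ = Λ * σ ^ p := by rw [hrp]; ring
        _ ≤ _ := hτ1.trans hac1
    have h3 : 5 / θ * Y ≤ M := by linarith
    calc 5 * σ = 5 / θ * Y * (θ * r) := by rw [hrσ]; field_simp
      _ ≤ _ := by gcongr
  have hstart : volume (window p γ xP cs r ∩ {z | s < f z}) ≤
      ENNReal.ofReal ε₀ * volume (window p γ xP cs r) := by
    have hsub : window p γ xP cs r ⊆ G.cell k i := by
      rintro y ⟨hy1, hy2⟩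
      have hrσ4 : r ≤ σ / 4 := by rw [hrσ]; gcongr
      refine G.mem_cell.2 ⟨fun b => ?_, ?_⟩
      · have := abs_le.1 (hy1 b)
        simp only [hxP] at this
        constructor <;> linarith
      · constructor
        · linarith [hy2.1]
        · have h1 := hy2.2
          have h2 : Δ + (1 - γ) * r ^ p = 2 * r ^ p := by rw [hΔ]; ring
          have h3 : ((i.2 : ℝ) + 1) * G.τ k = a + G.τ k := by rw [ha]; ring
          rw [h3]
          linarith
    calc volume (window p γ xP cs r ∩ {z | s < f z})
        ≤ volume (G.cell k i ∩ {z | s < f z}) := measure_mono (inter_subset_inter_left _ hsub)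
      _ ≤ _ := hs
      _ ≤ ENNReal.ofReal ε₀ * volume (window p γ xP cs r) := by
          rw [G.volume_cell, volume_window _ _ _ _ hr0.le, ← ENNReal.ofReal_mul (by positivity),
            ← ENNReal.ofReal_mul hε₀.le]
          refine ENNReal.ofReal_le_ofReal ?_
          calc min (1 / 2) (ε₀ * η) * (σ ^ n * G.τ k) ≤
                ε₀ * η * (σ ^ n * (2 * (Λ * σ ^ p))) := by
                gcongr
                exact min_le_right _ _
            _ = ε₀ * (r ^ n * ((1 - γ) * r ^ p)) := by
                have hσr : σ = r * Y := by rw [hrσ]; field_simp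
                rw [hrp, hσr, hη, mul_pow]; field_simp
            _ ≤ _ := by
                gcongr
                linarith
  have htravel := volume_window_travel
    (fun x x' c hx s => hstep f hf hctl x x' c r hr0 hx s) M xP z.1 cs s (fun b => by
      have h1 := hzx b
      have h2 := hxPz b
      have h3 := abs_sub_le (z.1 b) (z₀.1 b) (xP b)
      linarith) hstart
  have hend := hctl z.1 _ r hr0 _ htravel
  have hce : cs - M * ((1 + γ) * r ^ p) - (1 + γ) * r ^ p = c' := by rw [hcs, ← hΔ]; ring
  rw [hce] at hend
  have hsub : G.cell (k + q) (G.index (k + q) z) ⊆ window p γ z.1 c' r := by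
    intro y hy
    obtain ⟨h1, h2⟩ := G.abs_sub_lt_of_index_eq (k := k + q) (z := y) (z' := z) hy
    refine ⟨fun b => (h1 b).le, ?_⟩
    have h3 : G.τ (k + q) ≤ (1 - γ) * r ^ p / 2 := by nlinarith only [hτq2, hΛ', hrp0]
    have h4 := abs_lt.1 (h2.trans_le h3)
    rw [hc']
    constructor <;> linarith
  refine (measure_mono hsub).trans (hend.trans ?_)
  rw [G.volume_cell, volume_window _ _ _ _ hr0.le]
  calc K₀ * (K ^ M * s) * ENNReal.ofReal ((2 * r) ^ n * ((1 - γ) * r ^ p))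
      ≤ K₀ * (K ^ M₁ * s) * ENNReal.ofReal (2 ^ n * ((1 - γ) / Λ) * (r ^ n * G.τ (k + q))) := by
        refine mul_le_mul' (mul_le_mul_right (mul_le_mul_left (pow_le_pow_right₀ hK1 hMM₁) _) _)
          (ENNReal.ofReal_le_ofReal ?_)
        calc (2 * r) ^ n * ((1 - γ) * r ^ p)
            = 2 ^ n * ((1 - γ) / Λ) * (r ^ n * (Λ * r ^ p)) := by rw [mul_pow]; field_simp
          _ ≤ _ := by
              have : 0 ≤ (1 - γ) / Λ := by positivity
              gcongr
    _ = _ := by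
        rw [ENNReal.ofReal_mul (by positivity)]; ring

namespace ParabolicGrid

variable {n : ℕ} (G : ParabolicGrid n)

/-! ### Stacks of cells -/

theorem index_sub (k : ℕ) (z : (Fin n → ℝ) × ℝ) (l : ℕ) :
    G.index k (z.1, z.2 - l * G.τ k) = ((G.index k z).1, (G.index k z).2 - l) := by
  have := G.τ_pos k
  simp only [index, Prod.mk.injEq, true_and]
  rw [sub_div, mul_div_cancel_right₀ _ this.ne', Int.floor_sub_natCast]

/-- The indices of the `m + 2` cells below the cells of a family, the two nearest ones
excluded. -/
def stack (m : ℕ) (S : ℕ → Set ((Fin n → ℤ) × ℤ)) (k : ℕ) : Set ((Fin n → ℤ) × ℤ) :=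
  {i | ∃ l : ℕ, 3 ≤ l ∧ l ≤ m + 2 ∧ (i.1, i.2 + (l : ℤ)) ∈ S k}

/-- On each vertical line a stack is an interval of `m` cell heights; prolonging it upwards by three
heights, a fraction `3 / m`, covers the two skipped cells and the original one. Fubini reduces the
claim to the interval estimate. -/
theorem volume_iUnion_le_stack {m : ℕ} (hm : 0 < m) (S : ℕ → Set ((Fin n → ℤ) × ℤ)) :
    volume (⋃ k, G.index k ⁻¹' S k) ≤
      ENNReal.ofReal (1 + 3 / m) * volume (⋃ k, G.index k ⁻¹' stack m S k) := by
  have hm' : (0 : ℝ) < m := Nat.cast_pos.2 hm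
  have hU := G.isNestedPartition.measurableSet_iUnion S
  have hV := G.isNestedPartition.measurableSet_iUnion (stack m S)
  rw [Measure.volume_eq_prod, Measure.prod_apply hU, Measure.prod_apply hV,
    ← lintegral_const_mul _ (measurable_measure_prodMk_left hV)]
  refine lintegral_mono fun y => ?_
  set Q : ℕ × ((Fin n → ℤ) × ℤ) → ℝ × ℝ := fun b =>
    ((b.2.2 - (m + 2)) * G.τ b.1, (b.2.2 - 2) * G.τ b.1)
  set F : Set (ℝ × ℝ) := Q '' {b | b.2 ∈ S b.1 ∧
    b.2.1 = fun a => ⌊(y a - G.origin a) / G.s b.1⌋} with hF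
  have hlen : ∀ b, (Q b).2 + 3 / m * ((Q b).2 - (Q b).1) = (b.2.2 + 1) * G.τ b.1 := fun b => by
    simp only [Q]; field_simp; ring
  have h := volume_biUnion_Ico_extend_le (θ := 3 / m) (by positivity) (F := F)
    ((Set.to_countable _).image _) (by
      rintro _ ⟨b, -, rfl⟩
      have := G.τ_pos b.1
      simp only [Q]
      gcongr
      linarith)
  refine (measure_mono ?_).trans (h.trans (mul_le_mul_right (measure_mono ?_) _))
  · intro t ht
    simp only [mem_preimage, mem_iUnion] at ht
    obtain ⟨k, hk⟩ := ht
    refine mem_iUnion₂.2 ⟨_, ⟨(k, G.index k (y, t)), ⟨hk, rfl⟩, rfl⟩, ?_⟩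
    rw [hlen]
    have h1 := (G.mem_cell.1 (G.mem_cell_index k (y, t))).2
    refine ⟨le_trans ?_ h1.1, h1.2⟩
    have := G.τ_pos k
    simp only [Q]
    gcongr
    linarith
  · refine iUnion₂_subset ?_
    rintro _ ⟨⟨k, i⟩, ⟨hi, hiy⟩, rfl⟩ t ⟨ht1, ht2⟩
    have hτ := G.τ_pos k
    simp only [Q] at ht1 ht2 hiy
    simp only [mem_preimage, mem_iUnion]
    have h1 : i.2 - (m + 2) ≤ ⌊t / G.τ k⌋ := by
      rw [Int.le_floor]
      push_cast
      rwa [le_div_iff₀ hτ]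
    have h2 : ⌊t / G.τ k⌋ < i.2 - 2 := by
      rw [Int.floor_lt]
      push_cast
      rwa [div_lt_iff₀ hτ]
    refine ⟨k, (i.2 - ⌊t / G.τ k⌋).toNat, by omega, by omega, ?_⟩
    have h3 : (((i.2 - ⌊t / G.τ k⌋).toNat : ℕ) : ℤ) = i.2 - ⌊t / G.τ k⌋ :=
      Int.toNat_of_nonneg (by omega)
    have h4 : ((G.index k (y, t)).1, (G.index k (y, t)).2 +
        (((i.2 - ⌊t / G.τ k⌋).toNat : ℕ) : ℤ)) = i := by
      refine Prod.ext ?_ ?_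
      · exact hiy.symm
      · rw [h3]; simp [index]
    rw [h4]
    exact hi

/-! ### Past bounds -/

/-- If `f ≤ s` on most of a cell, then the averages of `f` over the cells that are smaller by the
factor `2 ^ q` and lie in the past are at most `C s`. -/
def PastBound (f : (Fin n → ℝ) × ℝ → ℝ≥0∞) (q : ℕ) (ε₁ N : ℝ) (C : ℝ≥0∞) : Prop :=
  ∀ (k : ℕ) (z₀ : (Fin n → ℝ) × ℝ) (s : ℝ≥0∞),
    volume (G.cell k (G.index k z₀) ∩ {z | s < f z}) ≤
      ENNReal.ofReal ε₁ * volume (G.cell k (G.index k z₀)) →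
    ∀ z : (Fin n → ℝ) × ℝ, (∀ a, |z.1 a - z₀.1 a| ≤ 4 * G.s k) →
      2 * G.τ k ≤ z₀.2 - z.2 → z₀.2 - z.2 ≤ N * G.τ k →
      volume.withDensity f (G.cell (k + q) (G.index (k + q) z)) ≤
        C * s * volume (G.cell (k + q) (G.index (k + q) z))

variable {G} {f : (Fin n → ℝ) × ℝ → ℝ≥0∞} {q : ℕ} {ε₁ N : ℝ} {C : ℝ≥0∞}

/-- The margins `G.s j` and `G.τ j` make every point of the larger cell admissible, and that cell is
partitioned into cells of generation `k + q`. -/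
theorem PastBound.cell_le (h : G.PastBound f q ε₁ N C) {j k : ℕ} (hjk : j ≤ k + q)
    {z₀ z₁ : (Fin n → ℝ) × ℝ} {s : ℝ≥0∞}
    (hs : volume (G.cell k (G.index k z₀) ∩ {z | s < f z}) ≤
      ENNReal.ofReal ε₁ * volume (G.cell k (G.index k z₀)))
    (hx : ∀ a, |z₁.1 a - z₀.1 a| + G.s j ≤ 4 * G.s k)
    (ht1 : 2 * G.τ k + G.τ j ≤ z₀.2 - z₁.2) (ht2 : z₀.2 - z₁.2 + G.τ j ≤ N * G.τ k) :
    volume.withDensity f (G.cell j (G.index j z₁)) ≤ C * s * volume (G.cell j (G.index j z₁)) := by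
  refine G.measure_cell_le hjk fun z hz => ?_
  obtain ⟨h1, h2⟩ := G.abs_sub_lt_of_index_eq (k := j) (z := z) (z' := z₁) hz
  have h3 := abs_lt.1 h2
  refine h k z₀ s hs z (fun a => ?_) (by linarith) (by linarith)
  have := abs_sub_le (z.1 a) (z₁.1 a) (z₀.1 a)
  linarith [h1 a, hx a]

/-- By Chebyshev, the level `A / ε₁` is exceeded on at most a fraction `ε₁` of a cell with average
`A`. -/
theorem PastBound.average_le (h : G.PastBound f q ε₁ N C) (hf : Measurable f) (hε₁ : 0 < ε₁)
    {j k : ℕ} (hjk : j ≤ k + q) {z₀ z₁ : (Fin n → ℝ) × ℝ}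
    (hx : ∀ a, |z₁.1 a - z₀.1 a| + G.s j ≤ 4 * G.s k)
    (ht1 : 2 * G.τ k + G.τ j ≤ z₀.2 - z₁.2) (ht2 : z₀.2 - z₁.2 + G.τ j ≤ N * G.τ k) :
    volume.withDensity f (G.cell j (G.index j z₁)) ≤
      C / ENNReal.ofReal ε₁ * (volume.withDensity f (G.cell k (G.index k z₀)) /
        volume (G.cell k (G.index k z₀))) * volume (G.cell j (G.index j z₁)) := by
  set A := volume.withDensity f (G.cell k (G.index k z₀)) / volume (G.cell k (G.index k z₀))
  have he : ENNReal.ofReal ε₁ ≠ 0 := (ENNReal.ofReal_pos.2 hε₁).ne'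
  have h1 := h.cell_le hjk (z₀ := z₀) (z₁ := z₁) (s := A / ENNReal.ofReal ε₁)
    (measure_inter_lt_le_of_withDensity_le hf (G.measurableSet_cell _ _) (by
      rw [ENNReal.mul_div_cancel he ENNReal.ofReal_ne_top,
        ENNReal.div_mul_cancel (G.volume_cell_ne_zero _ _) (G.volume_cell_ne_top _ _)])) hx ht1 ht2
  refine h1.trans (le_of_eq ?_)
  simp only [div_eq_mul_inv]
  ring

end ParabolicGrid

namespace ParabolicGrid

variable {n : ℕ} {G : ParabolicGrid n} {f : (Fin n → ℝ) × ℝ → ℝ≥0∞} {q m : ℕ} {ε₁ N : ℝ}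
  {C K : ℝ≥0∞}

/-! ### Decay of sublevel sets -/

theorem measurable_index (G : ParabolicGrid n) (k : ℕ) : Measurable (G.index k) :=
  measurable_to_countable' fun i => G.measurableSet_cell k i

/-- The average over the cell of generation `k` that lies four cells below the one of `z`. -/
noncomputable def pastAverage (G : ParabolicGrid n) (f : (Fin n → ℝ) × ℝ → ℝ≥0∞) (k : ℕ)
    (z : (Fin n → ℝ) × ℝ) : ℝ≥0∞ :=
  volume.withDensity f (G.cell k (G.index k (z.1, z.2 - 4 * G.τ k))) /
    volume (G.cell k (G.index k (z.1, z.2 - 4 * G.τ k)))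

theorem PastBound.pastAverage_le (h : G.PastBound f q ε₁ N C) (hf : Measurable f) (hε₁ : 0 < ε₁)
    (hN : 10 * 2 ^ G.p ≤ N) (hK : C / ENNReal.ofReal ε₁ ≤ K) (k : ℕ) (z : (Fin n → ℝ) × ℝ) :
    G.pastAverage f 0 z ≤ K ^ k * G.pastAverage f k z := by
  induction k with
  | zero => simp
  | succ k ih =>
    refine ih.trans ?_
    rw [pow_succ, mul_assoc]
    refine mul_le_mul_right (ENNReal.div_le_of_le_mul ?_) _
    have h0 := G.τ_pos (k + 1)
    have h1 := G.two_mul_τ_succ_le k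
    have h2 := G.τ_le_succ k
    have h3 := G.s_succ k
    have h4 := G.s_pos (k + 1)
    refine (h.average_le hf hε₁ (j := k) (k := k + 1) (by omega)
      (z₀ := (z.1, z.2 - 4 * G.τ (k + 1))) (z₁ := (z.1, z.2 - 4 * G.τ k)) (fun a => ?_)
      ?_ ?_).trans ?_
    · simp only [sub_self, abs_zero]; linarith
    -- The offset of four cells is used here: `4 τ_k - 4 τ_{k+1} ≥ τ_k + 2 τ_{k+1}` because `τ_k ≥ 2
    -- τ_{k+1}`.
    · linarith
    · have : 10 * 2 ^ G.p * G.τ (k + 1) ≤ N * G.τ (k + 1) := by gcongr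
      simp only
      nlinarith
    · refine mul_le_mul_left (mul_le_mul_left hK _) _

theorem volume_inter_lt_le_of_density {E : Set ((Fin n → ℝ) × ℝ)} (hE : MeasurableSet E)
    {s : ℝ≥0∞} (hs : ∀ z ∈ E, f z ≤ s) (hε₁ : 0 ≤ ε₁) (hε₁' : ε₁ ≤ 1)
    {k : ℕ} {i : (Fin n → ℤ) × ℤ}
    (h : ENNReal.ofReal (1 - ε₁) * volume (G.cell k i) ≤ volume (G.cell k i ∩ E)) :
    volume (G.cell k i ∩ {z | s < f z}) ≤ ENNReal.ofReal ε₁ * volume (G.cell k i) := by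
  have h1 : volume (G.cell k i ∩ {z | s < f z}) + volume (G.cell k i ∩ E) ≤
      volume (G.cell k i) := by
    rw [add_comm, ← measure_inter_add_sdiff (G.cell k i) hE]
    have hsub : G.cell k i ∩ {z | s < f z} ⊆ G.cell k i \ E := fun z hz =>
      ⟨hz.1, fun hzE => absurd (hs z hzE) (not_le.2 hz.2)⟩
    exact add_le_add_right (measure_mono hsub) _
  have hfin := G.volume_cell_ne_top k i
  refine ENNReal.le_of_add_le_add_right
    (ENNReal.mul_ne_top (ENNReal.ofReal_ne_top (r := 1 - ε₁)) hfin) ?_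
  calc _ ≤ volume (G.cell k i ∩ {z | s < f z}) + volume (G.cell k i ∩ E) := by gcongr
    _ ≤ volume (G.cell k i) := h1
    _ = _ := by
      rw [← add_mul, ← ENNReal.ofReal_add hε₁ (by linarith), add_sub_cancel, ENNReal.ofReal_one,
        one_mul]

/-- The part of the cylinder over the base cells with spatial index `0` with times in `(b, T)`. -/
def cylinder (G : ParabolicGrid n) (b T : ℝ) : Set ((Fin n → ℝ) × ℝ) :=
  {z | (G.index 0 z).1 = 0 ∧ z.2 ∈ Ioo b T}

theorem measurableSet_cylinder (G : ParabolicGrid n) (b T : ℝ) :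
    MeasurableSet (G.cylinder b T) :=
  (measurableSet_eq_fun (G.measurable_index 0).fst measurable_const).inter
    (measurable_snd measurableSet_Ioo)

theorem volume_cylinder (G : ParabolicGrid n) {b T : ℝ} :
    volume (G.cylinder b T) = ENNReal.ofReal (G.side ^ n) * ENNReal.ofReal (T - b) := by
  have : G.cylinder b T = (univ.pi fun a => Ico (G.origin a) (G.origin a + G.side)) ×ˢ Ioo b T := by
    ext z
    have := G.side_pos
    simp only [cylinder, index, mem_ofPred_eq, mem_prod, mem_univ_pi, funext_iff, Pi.zero_apply,
      Int.floor_eq_zero_iff, s_zero, mem_Ico]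
    refine and_congr (forall_congr' fun a => ?_) Iff.rfl
    rw [le_div_iff₀ this, div_lt_iff₀ this]
    constructor <;> rintro ⟨h, h'⟩ <;> constructor <;> linarith
  rw [this, Measure.volume_eq_prod, Measure.prod_prod, Real.volume_pi_Ico, Real.volume_Ioo]
  simp [ENNReal.ofReal_pow G.side_pos.le]

theorem volume_cylinder_ne_top (G : ParabolicGrid n) {b T : ℝ} :
    volume (G.cylinder b T) ≠ ∞ := by
  rw [volume_cylinder]
  exact ENNReal.mul_ne_top ENNReal.ofReal_ne_top ENNReal.ofReal_ne_top

/-- The measures of consecutive sublevel sets decay geometrically, up to a thin layer at the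
bottom. -/
theorem PastBound.volume_sublevel_succ_le (h : G.PastBound f q ε₁ N C) (hf : Measurable f)
    (hε₁ : 0 < ε₁) (hε₁' : ε₁ < 1) (hm : 0 < m) (hmε : 3 / m ≤ ε₁ / 2)
    (hN : (m + 10) * (2 * 2 ^ G.p) ≤ N)
    (hCK : C ≤ K) (hεK : C / ENNReal.ofReal ε₁ ≤ K) (hK1 : 1 ≤ K) {e : ℝ≥0∞} (he0 : e ≠ 0)
    (he : K ^ 2 * e ≤ ENNReal.ofReal (ε₁ / 8)) {A : ℝ≥0∞} (hA0 : A ≠ 0) (hA : A ≠ ∞)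
    {b T : ℝ} (hbase : ∀ z ∈ G.cylinder b T, A ≤ K * G.pastAverage f 0 z) (k : ℕ) :
    volume (G.cylinder b T ∩ {z | f z < e ^ (k + 1) * A}) ≤
      volume (G.cylinder b (b + (m + 4) * (G.height / 2 ^ k))) +
        ENNReal.ofReal (1 - ε₁ / 4) * volume (G.cylinder b T ∩ {z | f z < e ^ k * A}) := by
  set Ω := G.cylinder b T with hΩ
  have hΩm : MeasurableSet Ω := G.measurableSet_cylinder b T
  set b' := b + (m + 4) * (G.height / 2 ^ k) with hb'
  set s := e ^ (k + 1) * A with hs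
  have h2p : (0 : ℝ) < 2 ^ G.p := by positivity
  have hm0 : (0 : ℝ) ≤ m := Nat.cast_nonneg m
  have he1 : K ^ 2 * e < 1 := he.trans_lt (by
    rw [ENNReal.ofReal_lt_one]; linarith)
  have hetop : e ≠ ∞ := by
    rintro rfl
    rw [ENNReal.mul_top (pow_ne_zero _ (one_pos.trans_le hK1).ne')] at he1
    exact absurd he1 (by simp)
  -- Discarding the bottom layer ensures that the stacks below cells meeting `E` stay inside `Ω`.
  set E := {z ∈ Ω | f z < s ∧ b' < z.2} with hE
  have hEm : MeasurableSet E :=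
    hΩm.inter ((measurableSet_lt hf measurable_const).inter
      (measurableSet_lt measurable_const measurable_snd))
  have hEfin : volume E ≠ ∞ :=
    ne_top_of_le_ne_top G.volume_cylinder_ne_top (measure_mono fun z hz => hz.1)
  have hEs : ∀ z ∈ E, f z ≤ s := fun z hz => hz.2.1.le
  -- dense cells
  set c : ℝ≥0∞ := ENNReal.ofReal (1 - ε₁) with hc
  have hc0 : c ≠ 0 := (ENNReal.ofReal_pos.2 (by linarith)).ne'
  set D : ℕ → Set ((Fin n → ℤ) × ℤ) := fun j =>
    {i | c * volume (G.cell j i) ≤ volume (G.cell j i ∩ E)} with hD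
  have hDsmall : ∀ j, ∀ i ∈ D j, volume (G.cell j i ∩ {z | s < f z}) ≤
      ENNReal.ofReal ε₁ * volume (G.cell j i) := fun j i hi =>
    volume_inter_lt_le_of_density hEm hEs hε₁.le hε₁'.le hi
  have hDmem : ∀ j, ∀ i ∈ D j, ∃ z ∈ E, G.index j z = i := by
    intro j i hi
    have h1 : volume (G.cell j i ∩ E) ≠ 0 := by
      refine ((pos_iff_ne_zero.2 (mul_ne_zero hc0 (G.volume_cell_ne_zero j i))).trans_le hi).ne'
    obtain ⟨z, hz, hzE⟩ := nonempty_of_measure_ne_zero h1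
    exact ⟨z, hzE, hz⟩
  -- A dense cell of generation `j ≤ k` would make its past average at most `C s`. Comparing
  -- generations down to the base costs `K ^ j`, and the resulting `A ≤ (K ^ 2 * e) ^ (k + 1) * A`
  -- is absurd.
  have hDgen : ∀ j, ∀ i ∈ D j, k + 1 ≤ j := by
    intro j i hi
    obtain ⟨z, hzE, rfl⟩ := hDmem j i hi
    by_contra! hjk
    have hτ := G.τ_pos j
    have h1 : G.pastAverage f j z ≤ C * s := by
      refine ENNReal.div_le_of_le_mul ?_
      refine h.cell_le (by omega) (hDsmall j _ hi) (fun a => ?_) ?_ ?_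
      · simp only [sub_self, abs_zero]; linarith [G.s_pos j]
      · simp only; linarith
      · have h3 : (5 : ℝ) ≤ N := by
          have : (1 : ℝ) ≤ 2 ^ G.p := Real.one_le_rpow one_le_two (zero_le_one.trans G.one_le_p)
          nlinarith
        have : 5 * G.τ j ≤ N * G.τ j := by gcongr
        simp only; linarith
    have h2 : A ≤ K ^ (k + 2) * e ^ (k + 1) * A :=
      calc A ≤ K * G.pastAverage f 0 z := hbase z hzE.1
        _ ≤ K * (K ^ j * (K * s)) := by
            refine mul_le_mul_right ?_ _
            refine (h.pastAverage_le hf hε₁ (by nlinarith) hεK j z).trans ?_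
            exact mul_le_mul_right (h1.trans (mul_le_mul_left hCK _)) _
        _ ≤ K * (K ^ k * (K * s)) := by
            gcongr
            omega
        _ = _ := by rw [hs]; ring
    have h3 : K ^ (k + 2) * e ^ (k + 1) < 1 :=
      calc K ^ (k + 2) * e ^ (k + 1) ≤ K ^ (2 * (k + 1)) * e ^ (k + 1) := by
            gcongr
            omega
        _ = (K ^ 2 * e) ^ (k + 1) := by rw [mul_pow, pow_mul]
        _ < 1 := pow_lt_one₀ zero_le he1 (by omega)
    have h4 := ENNReal.mul_lt_mul_left hA0 hA h3
    rw [one_mul] at h4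
    exact absurd h2 (not_le.2 h4)
  -- parents of dense cells
  set S : ℕ → Set ((Fin n → ℤ) × ℤ) := fun j =>
    {i | i ∉ D j ∧ ∃ z, G.index j z = i ∧ G.index (j + 1) z ∈ D (j + 1)} with hS
  set U := ⋃ j, G.index j ⁻¹' S j with hU
  set V := ⋃ j, G.index j ⁻¹' stack m S j with hV
  have hEU : volume E ≤ volume (E ∩ U) := by
    have h0 := G.isNestedPartition.ae_exists_density
      (fun z O hO hz => G.exists_cell_subset hO hz) (μ := volume) (E := E) hEfin (c := c)
      (by rw [hc, ENNReal.ofReal_lt_one]; linarith)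
    have hsub : E ⊆ (E ∩ U) ∪ (E \ ⋃ j, G.index j ⁻¹' D j) := by
      classical
      intro z hz
      by_cases hzD : z ∈ ⋃ j, G.index j ⁻¹' D j
      · refine Or.inl ⟨hz, ?_⟩
        have hex : ∃ j, G.index j z ∈ D j := by simpa using hzD
        have hge := hDgen _ _ (Nat.find_spec hex)
        obtain ⟨j, hj⟩ : ∃ j, Nat.find hex = j + 1 := ⟨Nat.find hex - 1, by omega⟩
        -- The first dense generation is at least `k + 1`, so a parent exists, and minimality makes
        -- it non-dense.
        refine mem_iUnion.2 ⟨j, Nat.find_min hex (by omega), z, rfl, ?_⟩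
        rw [← hj]
        exact Nat.find_spec hex
      · exact Or.inr ⟨hz, hzD⟩
    calc volume E ≤ volume (E ∩ U) + volume (E \ ⋃ j, G.index j ⁻¹' D j) :=
          (measure_mono hsub).trans (measure_union_le _ _)
      _ = volume (E ∩ U) + 0 := congrArg _ h0
      _ = _ := add_zero _
  have hEU' : volume (E ∩ U) ≤ c * volume U := by
    have h0 := G.isNestedPartition.measure_iUnion_le (μ := volume.restrict E) (ν := volume)
      (c := c) S (by
        rintro j i ⟨hi, -⟩
        rw [Measure.restrict_apply (G.isNestedPartition.measurableSet_fiber j i)]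
        exact (not_le.1 hi).le)
    rw [Measure.restrict_apply (G.isNestedPartition.measurableSet_iUnion S), inter_comm] at h0
    exact h0
  have hUV : volume U ≤ ENNReal.ofReal (1 + ε₁ / 2) * volume V := by
    refine (G.volume_iUnion_le_stack hm S).trans (mul_le_mul_left (ENNReal.ofReal_le_ofReal ?_) _)
    linarith
  -- cells of the stacks
  have hstack : ∀ j, ∀ i ∈ stack m S j, G.cell j i ⊆ Ω ∧
      volume.withDensity f (G.cell j i) ≤ C * s * volume (G.cell j i) := by
    rintro j i ⟨l, hl3, hlm, -, z, hz, hzD⟩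
    obtain ⟨z₁, hz₁E, hz₁⟩ := hDmem _ _ hzD
    have hjk : k ≤ j := by have := hDgen _ _ hzD; omega
    have hz₁i : G.index j z₁ = (i.1, i.2 + (l : ℤ)) :=
      (G.isNestedPartition.eq_of_succ j _ _ hz₁).trans hz
    have hi : i = G.index j (z₁.1, z₁.2 - l * G.τ j) := by
      rw [G.index_sub, hz₁i]; simp
    have hl3' : (3 : ℝ) ≤ l := by exact_mod_cast hl3
    have hlm' : (l : ℝ) ≤ m + 2 := by exact_mod_cast hlm
    have h0 := G.τ_pos j
    have h0' := G.τ_pos (j + 1)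
    have h1 := G.two_mul_τ_succ_le j
    have h2 := G.τ_le_succ j
    have h3 : 3 * G.τ j ≤ l * G.τ j := by gcongr
    have h4 : l * G.τ j ≤ (m + 2) * G.τ j := by gcongr
    constructor
    · intro y hy
      have hy1 : G.index j y = G.index j (z₁.1, z₁.2 - l * G.τ j) := hy.trans hi
      have hy2 := abs_lt.1 (G.abs_sub_lt_of_index_eq hy1).2
      refine ⟨?_, ?_, ?_⟩
      · rw [G.isNestedPartition.eq_of_le (zero_le) hy1]
        exact hz₁E.1.1
      · have h5 : G.τ j ≤ G.height / 2 ^ k :=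
          (G.τ_le j).trans (div_le_div_of_nonneg_left G.height_pos.le (by positivity)
            (pow_le_pow_right₀ one_le_two hjk))
        have h6 : (m + 4) * G.τ j ≤ (m + 4) * (G.height / 2 ^ k) := by gcongr
        have h7 := hz₁E.2.2
        rw [hb'] at h7
        simp only at hy2
        linarith [hy2.1]
      · have h7 := hz₁E.1.2.2
        simp only at hy2
        linarith [hy2.2]
    · rw [hi]
      refine h.cell_le (k := j + 1) (z₀ := z₁) (by omega) ?_ (fun a => ?_) ?_ ?_
      · rw [hz₁]; exact hDsmall _ _ hzD
      · simp only [sub_self, abs_zero]; linarith [G.s_succ j, G.s_pos (j + 1)]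
      · simp only; linarith
      · have h5 : (m + 3) * G.τ j ≤ (m + 3) * (2 * 2 ^ G.p * G.τ (j + 1)) := by gcongr
        have h6 : (m + 10) * (2 * 2 ^ G.p) * G.τ (j + 1) ≤ N * G.τ (j + 1) := by gcongr
        have h7 : 0 < 2 * 2 ^ G.p * G.τ (j + 1) := by positivity
        simp only; linarith
  have hVm : MeasurableSet V := G.isNestedPartition.measurableSet_iUnion _
  have hVΩ : V ⊆ Ω := iUnion_subset fun j z hz => (hstack j _ hz).1 rfl
  have hVfin : volume V ≠ ∞ := ne_top_of_le_ne_top G.volume_cylinder_ne_top (measure_mono hVΩ)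
  set F := Ω ∩ {z | f z < e ^ k * A} with hF
  have hFfin : volume F ≠ ∞ :=
    ne_top_of_le_ne_top G.volume_cylinder_ne_top (measure_mono inter_subset_left)
  -- The average of `f` over `V` is at most `ε₁ / 8` times the previous level, so Chebyshev leaves
  -- at most the fraction `ε₁ / 8` of `V` outside `F`.
  have hVF : volume V ≤ volume F + ENNReal.ofReal (ε₁ / 8) * volume V := by
    have h1 : volume.withDensity f V ≤ C * s * volume V :=
      G.isNestedPartition.measure_iUnion_le _ fun j i hi => (hstack j i hi).2
    have h2 : volume.withDensity f V ≤
        ENNReal.ofReal (ε₁ / 8) * (e ^ k * A) * volume V := by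
      refine h1.trans (mul_le_mul_left ?_ _)
      calc C * s = C * e * (e ^ k * A) := by rw [hs]; ring
        _ ≤ K ^ 2 * e * (e ^ k * A) := by
            gcongr
            calc C ≤ K := hCK
              _ ≤ K ^ 2 := le_self_pow₀ hK1 two_ne_zero
        _ ≤ _ := by gcongr
    have hlev : e ^ k * A ≠ 0 := mul_ne_zero (pow_ne_zero _ he0) hA0
    have hlev' : e ^ k * A ≠ ∞ := ENNReal.mul_ne_top (ENNReal.pow_ne_top hetop) hA
    have h3 : volume (V ∩ {z | e ^ k * A ≤ f z}) ≤ ENNReal.ofReal (ε₁ / 8) * volume V := by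
      rw [withDensity_apply _ hVm] at h2
      have h4 := mul_meas_ge_le_lintegral (μ := volume.restrict V) hf (e ^ k * A)
      rw [Measure.restrict_apply' hVm, inter_comm] at h4
      refine (ENNReal.mul_le_mul_iff_right hlev hlev').1 (h4.trans (h2.trans (le_of_eq ?_)))
      ring
    calc volume V ≤ volume (F ∪ (V ∩ {z | e ^ k * A ≤ f z})) := by
          refine measure_mono fun z hz => ?_
          rcases lt_or_ge (f z) (e ^ k * A) with h5 | h5
          · exact Or.inl ⟨hVΩ hz, h5⟩
          · exact Or.inr ⟨hz, h5⟩
      _ ≤ _ := (measure_union_le _ _).trans (add_le_add_right h3 _)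
  have hEF : volume E ≤ ENNReal.ofReal (1 - ε₁ / 4) * volume F := by
    have h1 : volume E ≤ c * (ENNReal.ofReal (1 + ε₁ / 2) * volume V) :=
      hEU.trans (hEU'.trans (mul_le_mul_right hUV _))
    have h2 : (volume V).toReal ≤ (volume F).toReal + ε₁ / 8 * (volume V).toReal := by
      have := ENNReal.toReal_mono (ENNReal.add_ne_top.2
        ⟨hFfin, ENNReal.mul_ne_top ENNReal.ofReal_ne_top hVfin⟩) hVF
      rwa [ENNReal.toReal_add hFfin (ENNReal.mul_ne_top ENNReal.ofReal_ne_top hVfin),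
        ENNReal.toReal_mul, ENNReal.toReal_ofReal (by linarith)] at this
    rw [← ENNReal.ofReal_toReal hVfin, hc, ← ENNReal.ofReal_mul (by linarith),
      ← ENNReal.ofReal_mul (by linarith)] at h1
    rw [← ENNReal.ofReal_toReal hFfin, ← ENNReal.ofReal_mul (by linarith)]
    refine h1.trans (ENNReal.ofReal_le_ofReal ?_)
    have hv := ENNReal.toReal_nonneg (a := volume V)
    have h3 : (1 - ε₁ / 8) * (volume V).toReal ≤ (volume F).toReal := by linarith
    calc (1 - ε₁) * ((1 + ε₁ / 2) * (volume V).toReal)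
        ≤ (1 - ε₁ / 4) * ((1 - ε₁ / 8) * (volume V).toReal) := by
          rw [← mul_assoc, ← mul_assoc]
          refine mul_le_mul_of_nonneg_right ?_ hv
          nlinarith
      _ ≤ _ := mul_le_mul_of_nonneg_left h3 (by linarith)
  have hnull : volume {z : (Fin n → ℝ) × ℝ | z.2 = b'} = 0 := by
    have : {z : (Fin n → ℝ) × ℝ | z.2 = b'} = univ ×ˢ {b'} := by ext z; simp
    rw [this, Measure.volume_eq_prod, Measure.prod_prod]
    simp
  calc volume (Ω ∩ {z | f z < s})
      ≤ volume (G.cylinder b b' ∪ {z | z.2 = b'} ∪ E) := by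
        refine measure_mono fun z hz => ?_
        rcases lt_trichotomy z.2 b' with h1 | h1 | h1
        · exact Or.inl (Or.inl ⟨hz.1.1, hz.1.2.1, h1⟩)
        · exact Or.inl (Or.inr h1)
        · exact Or.inr ⟨hz.1, hz.2, h1⟩
    _ ≤ volume (G.cylinder b b') + 0 + volume E := by
        refine (measure_union_le _ _).trans (add_le_add_left ((measure_union_le _ _).trans ?_) _)
        rw [hnull]
    _ ≤ _ := by rw [add_zero]; exact add_le_add_right hEF _

end ParabolicGrid

/-! ### Geometric decay on a parabolic rectangle -/

theorem le_geometric_of_le_add {a : ℕ → ℝ} {B σ ρ M : ℝ} (hB : 0 ≤ B) (hσρ : σ < ρ)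
    (hσ : 0 ≤ σ) (hρ : 1 / 2 ≤ ρ) (h0 : a 0 ≤ M) (h : ∀ k, a (k + 1) ≤ B / 2 ^ k + σ * a k)
    (k : ℕ) : a k ≤ (max M 0 + B / (ρ - σ)) * ρ ^ k := by
  have hd : 0 < ρ - σ := sub_pos.2 hσρ
  have hM : 0 ≤ max M 0 := le_max_right _ _
  have hBd : 0 ≤ B / (ρ - σ) := by positivity
  induction k with
  | zero => simp; linarith [le_max_left M 0]
  | succ k ih =>
    have h1 : B / 2 ^ k ≤ B / (ρ - σ) * (ρ - σ) * ρ ^ k := by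
      rw [div_mul_cancel₀ _ hd.ne', div_eq_mul_inv, ← inv_pow, inv_eq_one_div]
      gcongr
    have h2 : 0 ≤ max M 0 * ((ρ - σ) * ρ ^ k) := by positivity
    calc a (k + 1) ≤ B / 2 ^ k + σ * a k := h k
      _ ≤ B / (ρ - σ) * (ρ - σ) * ρ ^ k + σ * ((max M 0 + B / (ρ - σ)) * ρ ^ k) := by gcongr
      _ ≤ _ := by rw [pow_succ]; linarith

theorem cube_sub_mem {n : ℕ} {x y : Fin n → ℝ} {L : ℝ} (hL : 0 < L) (hy : y ∈ cube x L)
    (a : Fin n) : 0 ≤ y a - (x a - 2 * L) ∧ y a - (x a - 2 * L) < 4 * L := by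
  have := abs_le.1 (hy a)
  constructor <;> linarith

set_option maxHeartbeats 1000000 in
/-- Under past control, the measure of the sublevel sets of `f` in the upper part of a parabolic
rectangle, at levels relative to the average over the lower part, decays geometrically. -/
theorem PastControl.exists_decay (n : ℕ) {p γ ε₀ : ℝ} {K₀ : ℝ≥0∞} (hp : 1 < p)
    (hγ0 : 0 < γ) (hγ1 : γ < 1) (hε₀ : 0 < ε₀) (hK₀ : K₀ ≠ ∞) :
    ∃ e ρ M : ℝ, 0 < e ∧ e < 1 ∧ 0 < ρ ∧ ρ < 1 ∧ 0 ≤ M ∧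
      ∀ f : (Fin n → ℝ) × ℝ → ℝ≥0∞, Measurable f → PastControl p γ ε₀ K₀ f →
      ∀ (x : Fin n → ℝ) (t L : ℝ), 0 < L → ∀ A : ℝ≥0∞, A ≠ 0 → A ≠ ∞ →
        A * volume (window p γ x (t - L ^ p) L) =
          volume.withDensity f (window p γ x (t - L ^ p) L) →
        ∀ k : ℕ, volume (window p γ x (t + γ * L ^ p) L ∩ {z | f z < ENNReal.ofReal e ^ k * A}) ≤
          ENNReal.ofReal (M * ρ ^ k) * volume (window p γ x (t + γ * L ^ p) L) := by
  have hg : 0 < 1 - γ := by linarith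
  have h4p : (0 : ℝ) < 4 ^ p := by positivity
  have h4p1 : (1 : ℝ) ≤ 4 ^ p := Real.one_le_rpow (by norm_num) (by linarith)
  -- Small enough for the Harnack estimate, and also for base cells of side `4 L` to be short
  -- compared with the time gap `2 γ L ^ p`.
  set Λ : ℝ := γ * (1 - γ) / (4 * 4 ^ p) with hΛ
  have hΛ0 : 0 < Λ := by positivity
  have hΛ4 : Λ * 4 ^ p = γ * (1 - γ) / 4 := by rw [hΛ]; field_simp
  have hΛ1 : Λ ≤ (1 - γ) / 4 := by
    have : Λ * 1 ≤ Λ * 4 ^ p := by gcongr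
    nlinarith
  obtain ⟨q, ε₁, hε₁, hε₁', hHM⟩ :=
    ParabolicGrid.exists_past_cell_bound n hp hγ0 hγ1 hε₀ hK₀ hΛ0 hΛ1
  obtain ⟨m, hm⟩ := exists_nat_ge (6 / ε₁)
  have hm0 : 0 < (m : ℝ) := lt_of_lt_of_le (by positivity) hm
  have hmε : 3 / (m : ℝ) ≤ ε₁ / 2 := by
    rw [div_le_iff₀ hε₁] at hm
    rw [div_le_iff₀ hm0]
    linarith
  have h2p : (0 : ℝ) < 2 ^ p := by positivity
  -- The first summand lets the bound reach down a whole stack, the second from the upper to the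
  -- lower part in units of the base height.
  set N : ℝ := (m + 10) * (2 * 2 ^ p) + 2 / (Λ * 4 ^ p) with hN
  obtain ⟨C, hC, hHM⟩ := hHM N (by positivity)
  set κ : ℝ := 2 ^ n * (1 + 2 * (Λ * 4 ^ p)) / (1 - γ) with hκ
  have h2n : (1 : ℝ) ≤ 2 ^ n := one_le_pow₀ one_le_two
  have hκ1 : 1 ≤ κ := by
    rw [hκ, le_div_iff₀ hg]
    have : 0 ≤ Λ * 4 ^ p := by positivity
    nlinarith
  have heε : ENNReal.ofReal ε₁ ≠ 0 := (ENNReal.ofReal_pos.2 hε₁).ne'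
  set K : ℝ≥0∞ := max 1 (max C (C / ENNReal.ofReal ε₁ * ENNReal.ofReal κ)) with hK
  have hKtop : K ≠ ∞ := (max_lt ENNReal.one_lt_top (max_lt hC.lt_top
    (ENNReal.mul_lt_top (ENNReal.div_lt_top hC heε) ENNReal.ofReal_lt_top))).ne
  have hK1 : 1 ≤ K := le_max_left _ _
  have hCK : C ≤ K := (le_max_left _ _).trans (le_max_right _ _)
  have hKκ : C / ENNReal.ofReal ε₁ * ENNReal.ofReal κ ≤ K :=
    (le_max_right _ _).trans (le_max_right _ _)
  have hKε : C / ENNReal.ofReal ε₁ ≤ K := by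
    refine le_trans ?_ hKκ
    exact le_mul_of_one_le_right zero_le (ENNReal.one_le_ofReal.2 hκ1)
  have hKr1 : 1 ≤ K.toReal := by
    simpa using ENNReal.toReal_mono hKtop hK1
  set e : ℝ := ε₁ / 8 / K.toReal ^ 2 with he
  have he0 : 0 < e := by positivity
  have he1 : e < 1 := by
    rw [he, div_lt_one (by positivity)]
    nlinarith
  have hKe : K ^ 2 * ENNReal.ofReal e ≤ ENNReal.ofReal (ε₁ / 8) := by
    rw [← ENNReal.ofReal_toReal hKtop, ← ENNReal.ofReal_pow (by positivity),
      ← ENNReal.ofReal_mul (by positivity)]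
    refine ENNReal.ofReal_le_ofReal (le_of_eq ?_)
    rw [he]; field_simp
  set σ : ℝ := 1 - ε₁ / 4 with hσ
  set ρ : ℝ := 1 - ε₁ / 8 with hρ
  set B : ℝ := 2 ^ n * ((m + 4) * (Λ * 4 ^ p)) / (1 - γ) with hB
  have hB0 : 0 ≤ B := by positivity
  refine ⟨e, ρ, 2 ^ n + B / (ρ - σ), he0, he1, by linarith, by linarith, ?_, ?_⟩
  · have : 0 < ρ - σ := by linarith
    positivity
  intro f hf hctl x t L hL A hA0 hA hAw
  have hLp : 0 < L ^ p := by positivity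
  set G : ParabolicGrid n :=
    { p := p, origin := fun a => x a - 2 * L, side := 4 * L, height := Λ * (4 * L) ^ p,
      one_le_p := hp.le, side_pos := by positivity, height_pos := by positivity } with hG
  have hGs : G.s 0 = 4 * L := G.s_zero
  have hGside : G.side = 4 * L := rfl
  have h4Lp : (4 * L) ^ p = 4 ^ p * L ^ p := Real.mul_rpow (by norm_num) hL.le
  have hGh : G.height = Λ * 4 ^ p * L ^ p := by
    change Λ * (4 * L) ^ p = _
    rw [h4Lp]; ring
  have hGτ : G.τ 0 = Λ * 4 ^ p * L ^ p := by rw [G.τ_zero, hGh]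
  have hPB : G.PastBound f q ε₁ N C := fun k z₀ s => hHM f hf hctl G rfl rfl k z₀ s
  have hidx : ∀ z : (Fin n → ℝ) × ℝ, z.1 ∈ cube x L → (G.index 0 z).1 = 0 := by
    intro z hz
    funext a
    have := cube_sub_mem hL hz a
    change ⌊(z.1 a - (x a - 2 * L)) / G.s 0⌋ = 0
    rw [hGs, Int.floor_eq_zero_iff]
    exact ⟨div_nonneg this.1 (by positivity), (div_lt_one (by positivity)).2 this.2⟩
  have hspace : ∀ z z' : (Fin n → ℝ) × ℝ, (G.index 0 z).1 = 0 → (G.index 0 z').1 = 0 →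
      ∀ a, |z.1 a - z'.1 a| < G.s 0 := by
    intro z z' hz hz'
    have : G.index 0 (z.1, z'.2) = G.index 0 z' := Prod.ext (hz.trans hz'.symm) rfl
    exact (G.abs_sub_lt_of_index_eq this).1
  have hvolU : volume (window p γ x (t + γ * L ^ p) L) =
      ENNReal.ofReal ((2 * L) ^ n * ((1 - γ) * L ^ p)) := volume_window _ _ _ _ hL.le
  have hvolL : volume (window p γ x (t - L ^ p) L) =
      ENNReal.ofReal ((2 * L) ^ n * ((1 - γ) * L ^ p)) := volume_window _ _ _ _ hL.le
  set v : ℝ := (2 * L) ^ n * ((1 - γ) * L ^ p) with hv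
  have hv0 : 0 < v := by positivity
  have h4Ln : (4 * L) ^ n = 2 ^ n * (2 * L) ^ n := by rw [← mul_pow]; ring_nf
  -- the base of the chain
  have hbase : ∀ z ∈ G.cylinder (t + γ * L ^ p) (t + L ^ p), A ≤ K * G.pastAverage f 0 z := by
    intro z hz
    set S : ℕ → Set ((Fin n → ℤ) × ℤ) := fun k =>
      {i | k = 0 ∧ ∃ z₁ ∈ window p γ x (t - L ^ p) L, G.index 0 z₁ = i} with hS
    -- Four heights for the offset in `pastAverage`, two for the time lag and one for the cell
    -- itself.
    have hτγ : 7 * G.τ 0 ≤ 2 * (γ * L ^ p) := by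
      rw [hGτ, hΛ4]
      have : 0 < γ * L ^ p := by positivity
      nlinarith
    have hle := G.isNestedPartition.measure_iUnion_le (μ := volume.withDensity f) (ν := volume)
      (c := C / ENNReal.ofReal ε₁ * G.pastAverage f 0 z) S (by
        rintro k i ⟨rfl, z₁, hz₁, rfl⟩
        have ht1 := hz₁.2.1
        have ht2 := hz₁.2.2
        have ht3 := hz.2.1
        have ht4 := hz.2.2
        have hτ0 := G.τ_pos 0
        refine hPB.average_le hf hε₁ (j := 0) (k := 0) (by omega) (z₀ := (z.1, z.2 - 4 * G.τ 0))
          (z₁ := z₁) (fun a => ?_) ?_ ?_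
        · have := hspace z₁ z (hidx _ hz₁.1) hz.1 a
          simp only
          linarith [G.s_pos 0]
        · simp only
          linarith
        · have h1 : 2 * L ^ p = 2 / (Λ * 4 ^ p) * G.τ 0 := by rw [hGτ]; field_simp
          have h2 : 0 ≤ (m + 10) * (2 * 2 ^ p) * G.τ 0 := by positivity
          simp only
          rw [hN, add_mul]
          linarith)
    have hsub1 : window p γ x (t - L ^ p) L ⊆ ⋃ k, G.index k ⁻¹' S k := fun z₁ hz₁ =>
      mem_iUnion.2 ⟨0, rfl, z₁, hz₁, rfl⟩
    have hsub2 : (⋃ k, G.index k ⁻¹' S k) ⊆ G.cylinder (t - L ^ p - G.τ 0) (t + G.τ 0) := by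
      refine iUnion_subset fun k z₂ hz₂ => ?_
      obtain ⟨rfl, z₁, hz₁, hi⟩ := hz₂
      have ht := abs_lt.1 (G.abs_sub_lt_of_index_eq hi).2
      have ht1 := hz₁.2.1
      have ht2 := hz₁.2.2
      have hγL : 0 < γ * L ^ p := by positivity
      exact ⟨by rw [← hi]; exact hidx _ hz₁.1, by linarith, by linarith⟩
    have hvolS : volume (⋃ k, G.index k ⁻¹' S k) ≤ ENNReal.ofReal κ * ENNReal.ofReal v := by
      refine (measure_mono hsub2).trans (le_of_eq ?_)
      rw [G.volume_cylinder, ← ENNReal.ofReal_mul (by positivity),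
        ← ENNReal.ofReal_mul (by positivity), hGside, h4Ln, hGτ, hκ, hv]
      congr 1
      field_simp
      ring
    have h5 : A * ENNReal.ofReal v ≤ K * G.pastAverage f 0 z * ENNReal.ofReal v := by
      rw [← hvolL, hAw, hvolL]
      calc _ ≤ _ := measure_mono hsub1
        _ ≤ _ := hle
        _ ≤ C / ENNReal.ofReal ε₁ * G.pastAverage f 0 z *
            (ENNReal.ofReal κ * ENNReal.ofReal v) := mul_le_mul_right hvolS _
        _ = C / ENNReal.ofReal ε₁ * ENNReal.ofReal κ * G.pastAverage f 0 z *
            ENNReal.ofReal v := by ring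
        _ ≤ _ := by gcongr
    exact (ENNReal.mul_le_mul_iff_left (ENNReal.ofReal_pos.2 hv0).ne' ENNReal.ofReal_ne_top).1 h5
  -- the recursion
  set Ω := G.cylinder (t + γ * L ^ p) (t + L ^ p) with hΩ
  set E : ℕ → Set ((Fin n → ℝ) × ℝ) := fun k =>
    Ω ∩ {z | f z < ENNReal.ofReal e ^ k * A} with hE
  have hEfin : ∀ k, volume (E k) ≠ ∞ := fun k =>
    ne_top_of_le_ne_top G.volume_cylinder_ne_top (measure_mono inter_subset_left)
  have hrec : ∀ k, (volume (E (k + 1))).toReal / v ≤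
      B / 2 ^ k + σ * ((volume (E k)).toReal / v) := by
    intro k
    have h1 := hPB.volume_sublevel_succ_le hf hε₁ hε₁' (Nat.cast_pos.1 hm0) hmε
      (by
        have : 0 ≤ 2 / (Λ * 4 ^ p) := by positivity
        change (m + 10) * (2 * 2 ^ p) ≤ N
        linarith)
      hCK hKε hK1 (ENNReal.ofReal_pos.2 he0).ne' hKe hA0 hA hbase k
    rw [G.volume_cylinder, add_sub_cancel_left, ← ENNReal.ofReal_mul (by positivity)] at h1
    have h2 := ENNReal.toReal_mono (ENNReal.add_ne_top.2 ⟨ENNReal.ofReal_ne_top,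
      ENNReal.mul_ne_top ENNReal.ofReal_ne_top (hEfin k)⟩) h1
    rw [ENNReal.toReal_add ENNReal.ofReal_ne_top (ENNReal.mul_ne_top ENNReal.ofReal_ne_top
      (hEfin k)), ENNReal.toReal_mul, ENNReal.toReal_ofReal (by rw [hGh]; positivity),
      ENNReal.toReal_ofReal (by linarith)] at h2
    rw [div_le_iff₀ hv0]
    refine h2.trans (le_of_eq ?_)
    rw [add_mul (B / 2 ^ k), mul_assoc σ, div_mul_cancel₀ _ hv0.ne', hGside, h4Ln, hGh, hB, hv]
    congr 1
    field_simp
  have hzero : (volume (E 0)).toReal / v ≤ 2 ^ n := by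
    rw [div_le_iff₀ hv0]
    have h1 : volume (E 0) ≤ ENNReal.ofReal (2 ^ n * v) := by
      refine (measure_mono inter_subset_left).trans (le_of_eq ?_)
      rw [G.volume_cylinder, ← ENNReal.ofReal_mul (by positivity), hGside, h4Ln, hv]
      congr 1
      ring
    have h2 := ENNReal.toReal_mono ENNReal.ofReal_ne_top h1
    rwa [ENNReal.toReal_ofReal (by positivity)] at h2
  intro k
  have hgeo := le_geometric_of_le_add (a := fun k => (volume (E k)).toReal / v) hB0
    (show σ < ρ by linarith) (by linarith) (by linarith) hzero hrec k
  rw [max_eq_left (by positivity), div_le_iff₀ hv0] at hgeo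
  have hsub : window p γ x (t + γ * L ^ p) L ∩ {z | f z < ENNReal.ofReal e ^ k * A} ⊆ E k := by
    rintro z ⟨hz, hz'⟩
    refine ⟨⟨hidx _ hz.1, hz.2.1, ?_⟩, hz'⟩
    have := hz.2.2
    linarith
  rw [hvolU, ← ENNReal.ofReal_mul (by
    have : 0 < ρ := by linarith
    have : 0 < ρ - σ := by linarith
    positivity)]
  calc _ ≤ volume (E k) := measure_mono hsub
    _ = ENNReal.ofReal (volume (E k)).toReal := (ENNReal.ofReal_toReal (hEfin k)).symm
    _ ≤ _ := ENNReal.ofReal_le_ofReal hgeo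

/-! ### From decay to integrability of a negative power -/

/-- If `e ^ (k + 1) * A ≤ y < e ^ k * A`, the `k`-th term alone suffices. For `y = 0` every
indicator is one and the series diverges, as it must. -/
theorem ENNReal.rpow_neg_le_tsum {e : ℝ} (he0 : 0 < e) (he1 : e < 1) {σ : ℝ} (hσ : 0 < σ)
    {A y : ℝ≥0∞} (hA0 : A ≠ 0) (hA : A ≠ ∞) :
    y ^ (-σ) ≤ A ^ (-σ) * (1 + ∑' k : ℕ, ENNReal.ofReal (e ^ (-σ)) ^ (k + 1) *
      (if y < ENNReal.ofReal e ^ k * A then 1 else 0)) := by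
  classical
  have hE0 : ENNReal.ofReal e ≠ 0 := (ENNReal.ofReal_pos.2 he0).ne'
  have hE1 : ENNReal.ofReal e < 1 := ENNReal.ofReal_lt_one.2 he1
  have hneg : ∀ {a b : ℝ≥0∞}, a ≤ b → b ^ (-σ) ≤ a ^ (-σ) := fun {a b} h => by
    rw [ENNReal.rpow_neg, ENNReal.rpow_neg, ENNReal.inv_le_inv]
    exact ENNReal.rpow_le_rpow h hσ.le
  have hg1 : 1 ≤ ENNReal.ofReal (e ^ (-σ)) := by
    rw [ENNReal.one_le_ofReal]
    exact Real.one_le_rpow_of_pos_of_le_one_of_nonpos he0 he1.le (by linarith)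
  rcases le_or_gt A y with h | h
  · calc y ^ (-σ) ≤ A ^ (-σ) * 1 := by rw [mul_one]; exact hneg h
      _ ≤ _ := by gcongr; exact le_self_add
  rcases eq_or_ne y 0 with rfl | hy
  · have hterm : ∀ k : ℕ, (1 : ℝ≥0∞) ≤ ENNReal.ofReal (e ^ (-σ)) ^ (k + 1) *
        (if 0 < ENNReal.ofReal e ^ k * A then 1 else 0) := fun k => by
      rw [if_pos (pos_iff_ne_zero.2 (mul_ne_zero (pow_ne_zero _ hE0) hA0)), mul_one]
      exact one_le_pow₀ hg1
    have htop : ∑' k : ℕ, ENNReal.ofReal (e ^ (-σ)) ^ (k + 1) *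
        (if 0 < ENNReal.ofReal e ^ k * A then 1 else 0) = ∞ := by
      refine top_le_iff.1 (le_trans (le_of_eq ?_) (ENNReal.tsum_le_tsum hterm))
      exact (ENNReal.tsum_const_eq_top_of_ne_zero one_ne_zero).symm
    rw [htop, add_top, ENNReal.mul_top]
    · exact le_top
    · rw [ENNReal.rpow_neg]
      exact ENNReal.inv_ne_zero.2 (ENNReal.rpow_ne_top_of_nonneg hσ.le hA)
  have hex : ∃ k : ℕ, ENNReal.ofReal e ^ (k + 1) * A ≤ y := by
    have h1 : Filter.Tendsto (fun k : ℕ => ENNReal.ofReal e ^ k * A) Filter.atTop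
        (nhds (0 * A)) :=
      ENNReal.Tendsto.mul_const (ENNReal.tendsto_pow_atTop_nhds_zero_of_lt_one hE1) (Or.inr hA)
    rw [zero_mul] at h1
    obtain ⟨k, hk⟩ := ((h1.comp (Filter.tendsto_add_atTop_nat 1)).eventually_lt_const
      (pos_iff_ne_zero.2 hy)).exists
    exact ⟨k, hk.le⟩
  set k := Nat.find hex with hk
  have hk1 : ENNReal.ofReal e ^ (k + 1) * A ≤ y := Nat.find_spec hex
  have hk2 : y < ENNReal.ofReal e ^ k * A := by
    rcases Nat.eq_zero_or_pos k with h0 | h0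
    · rw [h0]; simpa using h
    · have := Nat.find_min hex (m := k - 1) (by omega)
      rwa [Nat.sub_add_cancel h0, not_le] at this
  calc y ^ (-σ) ≤ (ENNReal.ofReal e ^ (k + 1) * A) ^ (-σ) := hneg hk1
    _ = A ^ (-σ) * (ENNReal.ofReal (e ^ (-σ)) ^ (k + 1) *
        (if y < ENNReal.ofReal e ^ k * A then 1 else 0)) := by
        rw [if_pos hk2, mul_one, ENNReal.mul_rpow_of_ne_top
          (ENNReal.pow_ne_top ENNReal.ofReal_ne_top) hA, mul_comm,
          ← ENNReal.ofReal_rpow_of_pos he0, ← ENNReal.rpow_natCast, ← ENNReal.rpow_natCast,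
          ← ENNReal.rpow_mul, ← ENNReal.rpow_mul, mul_comm (-σ)]
    _ ≤ _ := by
        gcongr
        exact (ENNReal.le_tsum (f := fun k => ENNReal.ofReal (e ^ (-σ)) ^ (k + 1) *
          (if y < ENNReal.ofReal e ^ k * A then 1 else 0)) k).trans le_add_self

theorem exists_lintegral_rpow_neg_le {X : Type*} [MeasurableSpace X] {e ρ M : ℝ} (he0 : 0 < e)
    (he1 : e < 1) (hρ0 : 0 < ρ) (hρ1 : ρ < 1) (hM : 0 ≤ M) :
    ∃ σ : ℝ, 0 < σ ∧ ∃ C : ℝ≥0∞, C ≠ ∞ ∧ ∀ (ν : Measure X) (f : X → ℝ≥0∞), Measurable f →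
      ∀ A V : ℝ≥0∞, A ≠ 0 → A ≠ ∞ → ν univ ≤ V →
        (∀ k : ℕ, ν {z | f z < ENNReal.ofReal e ^ k * A} ≤ ENNReal.ofReal (M * ρ ^ k) * V) →
        ∫⁻ z, f z ^ (-σ) ∂ν ≤ C * A ^ (-σ) * V := by
  have hle := Real.log_neg he0 he1
  have hlρ := Real.log_neg hρ0 hρ1
  -- Chosen so that `e ^ (-σ) = ρ ^ (-1 / 2)`: the growth of the power beats only half of the decay,
  -- and the ratio `g * ρ` is `ρ ^ (1 / 2)`.
  set σ : ℝ := Real.log ρ / (2 * Real.log e)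
  have hσ : 0 < σ := div_pos_of_neg_of_neg hlρ (by linarith)
  set g : ℝ := e ^ (-σ) with hg
  have hg0 : 0 < g := Real.rpow_pos_of_pos he0 _
  have hgρ : g * ρ < 1 := by
    have h1 : g = Real.exp (-(Real.log ρ / 2)) := by
      rw [hg, Real.rpow_def_of_pos he0]
      congr 1
      simp only [σ]
      have := hle.ne
      field_simp
    rw [h1]
    nth_rw 2 [← Real.exp_log hρ0]
    rw [← Real.exp_add, Real.exp_lt_one_iff]
    linarith
  set r : ℝ≥0∞ := ENNReal.ofReal (g * ρ) with hr
  have hr1 : r < 1 := ENNReal.ofReal_lt_one.2 hgρ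
  refine ⟨σ, hσ, 1 + ENNReal.ofReal (g * M) * (1 - r)⁻¹, ?_, ?_⟩
  · refine ENNReal.add_ne_top.2 ⟨ENNReal.one_ne_top, ENNReal.mul_ne_top ENNReal.ofReal_ne_top ?_⟩
    exact ENNReal.inv_ne_top.2 (tsub_pos_of_lt hr1).ne'
  intro ν f hf A V hA0 hA hV hk
  have hmeas : ∀ k : ℕ, MeasurableSet {z | f z < ENNReal.ofReal e ^ k * A} := fun k =>
    measurableSet_lt hf measurable_const
  have hmeas' : ∀ k : ℕ, Measurable fun z =>
      (if f z < ENNReal.ofReal e ^ k * A then (1 : ℝ≥0∞) else 0) := fun k =>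
    Measurable.ite (hmeas k) measurable_const measurable_const
  have hAσ : A ^ (-σ) ≠ ∞ := by
    rw [ENNReal.rpow_neg]
    exact ENNReal.inv_ne_top.2 (by
      rw [Ne, ENNReal.rpow_eq_zero_iff]
      rintro (h | h)
      · exact hA0 h.1
      · exact hA h.1)
  have hsum : ∫⁻ z, ∑' k : ℕ, ENNReal.ofReal g ^ (k + 1) *
      (if f z < ENNReal.ofReal e ^ k * A then 1 else 0) ∂ν ≤
      ENNReal.ofReal (g * M) * (1 - r)⁻¹ * V := by
    rw [lintegral_tsum fun k => ((hmeas' k).const_mul _).aemeasurable]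
    have hterm : ∀ k : ℕ, ∫⁻ z, ENNReal.ofReal g ^ (k + 1) *
        (if f z < ENNReal.ofReal e ^ k * A then 1 else 0) ∂ν ≤
        ENNReal.ofReal (g * M) * V * r ^ k := fun k => by
      rw [lintegral_const_mul _ (hmeas' k)]
      have h1 : ∫⁻ z, (if f z < ENNReal.ofReal e ^ k * A then (1 : ℝ≥0∞) else 0) ∂ν =
          ν {z | f z < ENNReal.ofReal e ^ k * A} := by
        rw [← lintegral_indicator_one (hmeas k)]
        refine lintegral_congr fun z => ?_
        simp [indicator_apply]
      rw [h1]
      calc _ ≤ ENNReal.ofReal g ^ (k + 1) * (ENNReal.ofReal (M * ρ ^ k) * V) := by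
            gcongr; exact hk k
        _ = _ := by
            rw [hr, ENNReal.ofReal_mul hM, ENNReal.ofReal_mul hg0.le, ENNReal.ofReal_mul hg0.le,
              ENNReal.ofReal_pow hρ0.le, mul_pow]
            ring
    refine (ENNReal.tsum_le_tsum hterm).trans (le_of_eq ?_)
    rw [ENNReal.tsum_mul_left, ENNReal.tsum_geometric]
    ring
  calc ∫⁻ z, f z ^ (-σ) ∂ν
      ≤ ∫⁻ z, A ^ (-σ) * (1 + ∑' k : ℕ, ENNReal.ofReal g ^ (k + 1) *
          (if f z < ENNReal.ofReal e ^ k * A then 1 else 0)) ∂ν :=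
        lintegral_mono fun z => ENNReal.rpow_neg_le_tsum he0 he1 hσ hA0 hA
    _ = A ^ (-σ) * (ν univ + ∫⁻ z, ∑' k : ℕ, ENNReal.ofReal g ^ (k + 1) *
          (if f z < ENNReal.ofReal e ^ k * A then 1 else 0) ∂ν) := by
        rw [lintegral_const_mul' _ _ hAσ, lintegral_add_left measurable_const, lintegral_one]
    _ ≤ A ^ (-σ) * (V + ENNReal.ofReal (g * M) * (1 - r)⁻¹ * V) := by gcongr
    _ = _ := by ring

/-! ### Parabolic rectangles and weights -/

namespace ParabolicRectangle

variable {n : ℕ} (p γ : ℝ) (R : ParabolicRectangle n)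

theorem upper_eq_window : R.upper p γ = window p γ R.x (R.t + γ * R.L ^ p) R.L := by
  rw [upper, window]; ring_nf

theorem lower_eq_window : R.lower p γ = window p γ R.x (R.t - R.L ^ p) R.L := by
  rw [lower, window]; ring_nf

theorem measurableSet_upper : MeasurableSet (R.upper p γ) := by
  rw [upper_eq_window]; exact measurableSet_window _ _ _ _ R.L_pos.le

theorem volume_lower_eq : volume (R.lower p γ) = volume (R.upper p γ) := by
  rw [upper_eq_window, lower_eq_window, volume_window _ _ _ _ R.L_pos.le,
    volume_window _ _ _ _ R.L_pos.le]

theorem volume_upper_ne_top : volume (R.upper p γ) ≠ ∞ := by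
  rw [upper_eq_window, volume_window _ _ _ _ R.L_pos.le]
  exact ENNReal.ofReal_ne_top

theorem volume_upper_ne_zero {γ : ℝ} (hγ : γ < 1) : volume (R.upper p γ) ≠ 0 := by
  rw [upper_eq_window, volume_window _ _ _ _ R.L_pos.le]
  have := R.L_pos
  have : 0 < 1 - γ := by linarith
  exact (ENNReal.ofReal_pos.2 (by positivity)).ne'

end ParabolicRectangle

namespace IsWeight

variable {n : ℕ} {w : (Fin n → ℝ) × ℝ → ℝ}

theorem integrableOn_window (hw : IsWeight w) (p γ : ℝ) (x : Fin n → ℝ) (c : ℝ) {r : ℝ}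
    (hr : 0 ≤ r) : IntegrableOn w (window p γ x c r) := by
  refine (hw.locallyIntegrable.integrableOn_isCompact
    ((isCompact_closedBall x r).prod (isCompact_Icc (a := c) (b := c + (1 - γ) * r ^ p)))).mono_set ?_
  rw [window, cube_eq_closedBall x hr]
  exact prod_mono_right Ioo_subset_Icc_self

theorem integrableOn_upper (hw : IsWeight w) (p γ : ℝ) (R : ParabolicRectangle n) :
    IntegrableOn w (R.upper p γ) := by
  rw [R.upper_eq_window]; exact hw.integrableOn_window _ _ _ _ R.L_pos.le

theorem integrableOn_lower (hw : IsWeight w) (p γ : ℝ) (R : ParabolicRectangle n) :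
    IntegrableOn w (R.lower p γ) := by
  rw [R.lower_eq_window]; exact hw.integrableOn_window _ _ _ _ R.L_pos.le

theorem aemeasurable (hw : IsWeight w) : AEMeasurable w :=
  hw.locallyIntegrable.aestronglyMeasurable.aemeasurable

theorem average_lower_nonneg (hw : IsWeight w) (p γ : ℝ) (R : ParabolicRectangle n) :
    0 ≤ ⨍ y in R.lower p γ, w y := by
  rw [setAverage_eq]
  exact smul_nonneg (by positivity) (integral_nonneg hw.nonneg)

theorem weightMeasure_lower (hw : IsWeight w) (p : ℝ) {γ : ℝ} (hγ : γ < 1)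
    (R : ParabolicRectangle n) : weightMeasure w (R.lower p γ) =
      ENNReal.ofReal (⨍ y in R.lower p γ, w y) * volume (R.upper p γ) := by
  have h0 := R.volume_upper_ne_zero p hγ
  have htop := R.volume_upper_ne_top p γ
  rw [weightMeasure, withDensity_apply', ← ofReal_integral_eq_lintegral_ofReal
    (hw.integrableOn_lower p γ R) (Filter.Eventually.of_forall hw.nonneg), setAverage_eq,
    measureReal_def, R.volume_lower_eq, smul_eq_mul]
  nth_rw 2 [← ENNReal.ofReal_toReal htop]
  rw [← ENNReal.ofReal_mul' ENNReal.toReal_nonneg]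
  congr 1
  have := (ENNReal.toReal_pos h0 htop).ne'
  field_simp

theorem nullMeasurableSet_sublevel (hw : IsWeight w) (p γ c : ℝ) (R : ParabolicRectangle n) :
    NullMeasurableSet (R.upper p γ ∩ {z | w z < c}) :=
  (R.measurableSet_upper p γ).nullMeasurableSet.inter
    (nullMeasurableSet_lt hw.aemeasurable aemeasurable_const)

/-- The Muckenhoupt condition gives a quantitative comparison of Lebesgue measure with the weighted
measure. -/
theorem exists_volume_le_of_muckenhoupt (hw : IsWeight w) {p γ q : ℝ} (hγ : γ < 1) (hq : 1 < q)
    (hA : muckenhouptConst p γ q w < ∞) :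
    ∃ K δ : ℝ, 0 < K ∧ 0 < δ ∧ ∀ R : ParabolicRectangle n,
      weightMeasure w (R.lower p γ) ≠ 0 →
      ∀ E : Set ((Fin n → ℝ) × ℝ), MeasurableSet E → E ⊆ R.upper p γ →
        volume E / volume (R.upper p γ) ≤
          ENNReal.ofReal K * (weightMeasure w E / weightMeasure w (R.lower p γ)) ^ δ := by
  set A := muckenhouptConst p γ q w with hAdef
  have hq0 : 0 < q := by linarith
  have hq1 : 0 < q - 1 := by linarith
  refine ⟨(A ^ (1 / q)).toReal + 1, 1 / q, by positivity, by positivity, ?_⟩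
  intro R hR E hE hEU
  set V := volume (R.upper p γ) with hV
  have hV0 : V ≠ 0 := R.volume_upper_ne_zero p hγ
  have hVtop : V ≠ ∞ := R.volume_upper_ne_top p γ
  set f : (Fin n → ℝ) × ℝ → ℝ≥0∞ := fun z => ENNReal.ofReal (w z) with hf
  have hfm : AEMeasurable f := hw.aemeasurable.ennreal_ofReal
  set B := weightMeasure w (R.lower p γ) with hB
  have hBtop : B ≠ ∞ := by
    rw [hB, hw.weightMeasure_lower p hγ R]
    exact ENNReal.mul_ne_top ENNReal.ofReal_ne_top hVtop
  set I := ∫⁻ z in R.upper p γ, f z ^ (1 / (1 - q)) with hI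
  have hAR : B / V * (I / V) ^ (q - 1) ≤ A := by
    have h1 : (⨍⁻ z in R.lower p γ, ENNReal.ofReal (w z) ∂volume) *
        (⨍⁻ z in R.upper p γ, ENNReal.ofReal (w z) ^ (1 / (1 - q)) ∂volume) ^ (q - 1) ≤ A :=
      le_iSup (fun R : ParabolicRectangle n =>
        (⨍⁻ z in R.lower p γ, ENNReal.ofReal (w z) ∂volume) *
        (⨍⁻ z in R.upper p γ, ENNReal.ofReal (w z) ^ (1 / (1 - q)) ∂volume) ^ (q - 1)) R
    simp only [setLAverage_eq, R.volume_lower_eq] at h1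
    rw [hB, weightMeasure, withDensity_apply']
    exact h1
  have hBV0 : B / V ≠ 0 := ENNReal.div_ne_zero.2 ⟨hR, hVtop⟩
  have hIV : I / V ≠ ∞ := by
    intro h
    rw [h, ENNReal.top_rpow_of_pos hq1, ENNReal.mul_top hBV0] at hAR
    exact absurd hA (not_lt.2 hAR)
  have hItop : I ≠ ∞ := by
    intro h
    rw [h, ENNReal.top_div_of_ne_top hVtop] at hIV
    exact hIV rfl
  have hexp : 1 / (1 - q) < 0 := div_neg_of_pos_of_neg one_pos (by linarith)
  -- Since the lower part has positive weight, the dual integral `I` is finite, so `f` cannot vanish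
  -- on a set of positive measure; this allows Hölder for `1 = f ^ (1 / q) * f ^ (-(1 / q))`.
  have hpos : ∀ᵐ z ∂volume.restrict E, f z ≠ 0 := by
    have h1 : ∀ᵐ z ∂volume.restrict (R.upper p γ), f z ^ (1 / (1 - q)) < ∞ :=
      ae_lt_top' (hfm.restrict.pow_const _) hItop
    filter_upwards [ae_restrict_of_ae_restrict_of_subset hEU h1] with z hz h0
    rw [h0, ENNReal.zero_rpow_of_neg hexp] at hz
    exact absurd hz (lt_irrefl _)
  set m := weightMeasure w E with hm
  have hconj : q.HolderConjugate (q / (q - 1)) := Real.HolderConjugate.conjExponent hq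
  have hholder : volume E ≤ m ^ (1 / q) * I ^ ((q - 1) / q) := by
    have h1 := ENNReal.lintegral_mul_le_Lp_mul_Lq (volume.restrict E) hconj
      (f := fun z => f z ^ (1 / q)) (g := fun z => f z ^ (-(1 / q)))
      (hfm.restrict.pow_const _) (hfm.restrict.pow_const _)
    have h2 : ∫⁻ z in E, ((fun z => f z ^ (1 / q)) * fun z => f z ^ (-(1 / q))) z =
        volume E := by
      rw [← setLIntegral_one]
      refine lintegral_congr_ae ?_
      filter_upwards [hpos] with z hz
      rw [Pi.mul_apply, ← ENNReal.rpow_add _ _ hz ENNReal.ofReal_ne_top, add_neg_cancel,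
        ENNReal.rpow_zero]
    have h3 : ∫⁻ z in E, (f z ^ (1 / q)) ^ q = m := by
      rw [hm, weightMeasure, withDensity_apply']
      refine lintegral_congr fun z => ?_
      rw [← ENNReal.rpow_mul, one_div_mul_cancel hq0.ne', ENNReal.rpow_one]
    have h4 : ∫⁻ z in E, (f z ^ (-(1 / q))) ^ (q / (q - 1)) ≤ I := by
      refine le_trans (le_of_eq ?_) (lintegral_mono_set hEU)
      refine lintegral_congr fun z => ?_
      rw [← ENNReal.rpow_mul]
      congr 1
      have : 1 - q ≠ 0 := by linarith
      have := hq1.ne'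
      field_simp
      ring
    rw [h2, h3, one_div_div] at h1
    refine h1.trans ?_
    gcongr
  have hsplit : V = V ^ (1 / q) * V ^ ((q - 1) / q) := by
    rw [← ENNReal.rpow_add _ _ hV0 hVtop]
    have : 1 / q + (q - 1) / q = 1 := by field_simp; ring
    rw [this, ENNReal.rpow_one]
  calc volume E / V ≤ m ^ (1 / q) * I ^ ((q - 1) / q) / V := ENNReal.div_le_div_right hholder _
    _ = (m / V) ^ (1 / q) * (I / V) ^ ((q - 1) / q) := by
        have e1 : 0 ≤ 1 / q := by positivity
        have e2 : 0 ≤ (q - 1) / q := by positivity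
        rw [ENNReal.div_rpow_of_nonneg _ _ e1, ENNReal.div_rpow_of_nonneg _ _ e2]
        nth_rw 1 [hsplit]
        generalize 1 / q = a at *
        generalize (q - 1) / q = b at *
        rw [div_eq_mul_inv, div_eq_mul_inv, div_eq_mul_inv, ENNReal.mul_inv
          (Or.inl (by simp [ENNReal.rpow_eq_zero_iff, hV0, hVtop]))
          (Or.inl (ENNReal.rpow_ne_top_of_nonneg e1 hVtop))]
        ring
    _ = (m / V * (I / V) ^ (q - 1)) ^ (1 / q) := by
        rw [ENNReal.mul_rpow_of_nonneg _ _ (by positivity), ← ENNReal.rpow_mul, mul_one_div]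
    _ = (m / B * (B / V * (I / V) ^ (q - 1))) ^ (1 / q) := by
        rw [← mul_assoc]
        congr 2
        rw [div_eq_mul_inv m B, mul_assoc, ← mul_div_assoc, ENNReal.inv_mul_cancel hR hBtop,
          one_div, div_eq_mul_inv]
    _ ≤ (m / B * A) ^ (1 / q) := by gcongr
    _ = A ^ (1 / q) * (m / B) ^ (1 / q) := by
        rw [ENNReal.mul_rpow_of_nonneg _ _ (by positivity), mul_comm]
    _ ≤ _ := by
        gcongr
        rw [← ENNReal.ofReal_toReal (ENNReal.rpow_ne_top_of_nonneg (by positivity) hA.ne)]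
        exact ENNReal.ofReal_le_ofReal (by rw [ENNReal.toReal_ofReal (by positivity)]; linarith)

/-- A bound for the measure of sublevel sets from a bound for arbitrary subsets. -/
theorem volume_sublevel_lt (hw : IsWeight w) {p γ α β : ℝ} (hγ : γ < 1) (hα : 0 < α) (hβ : 0 < β)
    (R : ParabolicRectangle n)
    (h : ∀ E : Set ((Fin n → ℝ) × ℝ), MeasurableSet E → E ⊆ R.upper p γ →
      weightMeasure w E < ENNReal.ofReal β * weightMeasure w (R.lower p γ) →
      volume E < ENNReal.ofReal α * volume (R.upper p γ)) :
    volume (R.upper p γ ∩ {z | w z < β * ⨍ y in R.lower p γ, w y}) <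
      ENNReal.ofReal α * volume (R.upper p γ) := by
  set c := β * ⨍ y in R.lower p γ, w y with hc
  obtain ⟨E, hEsub, hE, hEae⟩ :=
    (hw.nullMeasurableSet_sublevel p γ c R).exists_measurable_subset_ae_eq
  rw [← measure_congr hEae]
  have hVtop := R.volume_upper_ne_top p γ
  rcases eq_or_ne (volume E) 0 with h0 | h0
  · rw [h0]
    exact pos_iff_ne_zero.2 (mul_ne_zero (ENNReal.ofReal_pos.2 hα).ne'
      (R.volume_upper_ne_zero p hγ))
  have hEU : E ⊆ R.upper p γ := fun z hz => (hEsub hz).1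
  refine h E hE hEU ?_
  have hEtop : volume E ≠ ∞ := ne_top_of_le_ne_top hVtop (measure_mono hEU)
  -- Strict because `w < c` throughout `E` and `E` is not null; the null case had to be settled
  -- first.
  have hlt : weightMeasure w E < ENNReal.ofReal c * volume E := by
    rw [weightMeasure, withDensity_apply _ hE, ← setLIntegral_const]
    refine setLIntegral_strict_mono hE h0 measurable_const ?_ ?_
    · have := (hw.integrableOn_upper p γ R).mono_set hEU
      exact (this.lintegral_lt_top).ne
    · refine Filter.Eventually.of_forall fun z hz => ?_
      have h1 : w z < c := (hEsub hz).2
      exact (ENNReal.ofReal_lt_ofReal_iff ((hw.nonneg z).trans_lt h1)).2 h1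
  refine hlt.trans_le ?_
  rw [hw.weightMeasure_lower p hγ R, hc, ENNReal.ofReal_mul hβ.le, mul_assoc]
  gcongr

/-- The negative part is at most `(1 - β) A` off the sublevel set and at most `A` on it, since `w ≥
0`; averaging gives `(1 - β) A + α β A`. -/
theorem average_negPart_le (hw : IsWeight w) {p γ α β : ℝ} (hγ : γ < 1) (hα : 0 < α)
    (hβ : 0 < β) (hβ1 : β < 1) (R : ParabolicRectangle n)
    (h : volume (R.upper p γ ∩ {z | w z < β * ⨍ y in R.lower p γ, w y}) <
      ENNReal.ofReal α * volume (R.upper p γ)) :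
    ⨍ z in R.upper p γ, (w z - ⨍ y in R.lower p γ, w y)⁻ ≤
      (1 - β * (1 - α)) * ⨍ y in R.lower p γ, w y := by
  set A := ⨍ y in R.lower p γ, w y with hA
  have hA0 : 0 ≤ A := hw.average_lower_nonneg p γ R
  set U := R.upper p γ with hU
  have hUm : MeasurableSet U := R.measurableSet_upper p γ
  have hVtop : volume U ≠ ∞ := R.volume_upper_ne_top p γ
  have hV : 0 < volume.real U := ENNReal.toReal_pos (R.volume_upper_ne_zero p hγ) hVtop
  set T := toMeasurable volume (U ∩ {z | w z < β * A}) with hT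
  have hTm : MeasurableSet T := measurableSet_toMeasurable _ _
  have hTV : volume.real (T ∩ U) ≤ α * volume.real U := by
    have h1 : volume (T ∩ U) ≤ ENNReal.ofReal α * volume U :=
      (measure_mono inter_subset_left).trans (by rw [hT, measure_toMeasurable]; exact h.le)
    have h2 := ENNReal.toReal_mono (ENNReal.mul_ne_top ENNReal.ofReal_ne_top hVtop) h1
    rwa [ENNReal.toReal_mul, ENNReal.toReal_ofReal hα.le] at h2
  have hconst : ∀ c : ℝ, IntegrableOn (fun _ : (Fin n → ℝ) × ℝ => c) U := fun c =>
    integrableOn_const hVtop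
  have hint : ∫ z in U, (w z - A)⁻ ≤
      ∫ z in U, ((1 - β) * A + T.indicator (fun _ => β * A) z) := by
    refine integral_mono_of_nonneg (Filter.Eventually.of_forall fun z => negPart_nonneg _)
      ((hconst _).add ((hconst _).indicator hTm)) ?_
    filter_upwards [ae_restrict_mem hUm] with z hz
    have hwz := hw.nonneg z
    rw [negPart_def]
    by_cases h1 : w z < β * A
    · have h2 : z ∈ T := subset_toMeasurable _ _ ⟨hz, h1⟩
      rw [indicator_of_mem h2]
      exact max_le (by linarith) (by nlinarith)
    · have h2 : 0 ≤ T.indicator (fun _ => β * A) z :=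
        indicator_nonneg (fun _ _ => by positivity) z
      exact max_le (by linarith) (by nlinarith)
  rw [integral_add (hconst _) ((hconst _).indicator hTm), integral_indicator hTm,
    setIntegral_const, Measure.restrict_restrict hTm, setIntegral_const, smul_eq_mul,
    smul_eq_mul] at hint
  rw [setAverage_eq, smul_eq_mul, inv_mul_le_iff₀ hV]
  have h3 : volume.real (T ∩ U) * (β * A) ≤ α * volume.real U * (β * A) := by gcongr
  linarith

/-- Chebyshev: on the sublevel set the negative part exceeds `(1 - β) A`. If `A = 0` the set is
empty. -/
theorem volume_sublevel_le_of_average_negPart_le (hw : IsWeight w) {p γ β ε : ℝ} (hγ : γ < 1)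
    (hβ1 : β < 1) (R : ParabolicRectangle n)
    (h : ⨍ z in R.upper p γ, (w z - ⨍ y in R.lower p γ, w y)⁻ ≤
      ε * ⨍ y in R.lower p γ, w y) (hε : 0 ≤ ε) :
    volume (R.upper p γ ∩ {z | w z < β * ⨍ y in R.lower p γ, w y}) ≤
      ENNReal.ofReal (ε / (1 - β)) * volume (R.upper p γ) := by
  set A := ⨍ y in R.lower p γ, w y with hA
  have hβ' : 0 < 1 - β := by linarith
  rcases (hw.average_lower_nonneg p γ R).eq_or_lt with h0 | hA0
  · have : R.upper p γ ∩ {z | w z < β * A} = ∅ := by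
      refine eq_empty_of_forall_notMem fun z hz => ?_
      have h1 : w z < β * A := hz.2
      rw [hA, ← h0, mul_zero] at h1
      exact absurd h1 (not_lt.2 (hw.nonneg z))
    rw [this, measure_empty]
    exact zero_le
  rw [← hA] at hA0
  obtain ⟨E, hEsub, hE, hEae⟩ :=
    (hw.nullMeasurableSet_sublevel p γ (β * A) R).exists_measurable_subset_ae_eq
  rw [← measure_congr hEae]
  set U := R.upper p γ with hU
  have hVtop : volume U ≠ ∞ := R.volume_upper_ne_top p γ
  have hV : 0 < volume.real U := ENNReal.toReal_pos (R.volume_upper_ne_zero p hγ) hVtop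
  have hEU : E ⊆ U := fun z hz => (hEsub hz).1
  have hEtop : volume E ≠ ∞ := ne_top_of_le_ne_top hVtop (measure_mono hEU)
  have hconst : ∀ c : ℝ, IntegrableOn (fun _ : (Fin n → ℝ) × ℝ => c) U := fun c =>
    integrableOn_const hVtop
  have hI : IntegrableOn (fun z => (w z - A)⁻) U := by
    have := ((hw.integrableOn_upper p γ R).sub (hconst A)).neg_part
    refine this.congr (Filter.Eventually.of_forall fun z => ?_)
    simp [negPart_def]
  have hint : ∫ z in U, E.indicator (fun _ => (1 - β) * A) z ≤ ∫ z in U, (w z - A)⁻ := by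
    refine integral_mono ((hconst _).indicator hE) hI fun z => ?_
    by_cases hz : z ∈ E
    · have h1 : w z < β * A := (hEsub hz).2
      simp only [indicator_of_mem hz, negPart_def]
      exact le_max_of_le_left (by linarith)
    · simp only [indicator_of_notMem hz]
      exact negPart_nonneg _
  rw [integral_indicator hE, setIntegral_const, smul_eq_mul, measureReal_restrict_apply hE,
    inter_eq_self_of_subset_left hEU] at hint
  rw [setAverage_eq, smul_eq_mul, inv_mul_le_iff₀ hV] at h
  have h2 : volume.real E ≤ ε / (1 - β) * volume.real U := by
    rw [div_mul_eq_mul_div, le_div_iff₀ hβ']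
    refine le_of_mul_le_mul_right ?_ hA0
    linarith
  rw [← ENNReal.ofReal_toReal hEtop, ← ENNReal.ofReal_toReal hVtop,
    ← ENNReal.ofReal_mul (by positivity)]
  exact ENNReal.ofReal_le_ofReal h2

/-- The sublevel set condition gives past control. -/
theorem pastControl (hw : IsWeight w) {p γ α β : ℝ} (hγ : γ < 1) (hα0 : 0 < α) (hα : α < 1)
    (hβ : 0 < β)
    (h : ∀ R : ParabolicRectangle n,
      volume (R.upper p γ ∩ {z | w z < β * ⨍ y in R.lower p γ, w y}) <
        ENNReal.ofReal α * volume (R.upper p γ))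
    {f : (Fin n → ℝ) × ℝ → ℝ≥0∞} (hf : (fun z => ENNReal.ofReal (w z)) =ᵐ[volume] f) :
    PastControl p γ (1 - α) (ENNReal.ofReal β⁻¹) f := by
  intro x c r hr s hs
  set R : ParabolicRectangle n := ⟨x, c - γ * r ^ p, r, hr⟩ with hR
  have hup : R.upper p γ = window p γ x c r := by
    rw [R.upper_eq_window]; simp [hR]
  have hlow : R.lower p γ = window p γ x (c - (1 + γ) * r ^ p) r := by
    rw [R.lower_eq_window]; simp only [hR]; ring_nf
  set A := ⨍ y in R.lower p γ, w y with hA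
  have hVtop := R.volume_upper_ne_top p γ
  have hμ : volume.withDensity f (R.lower p γ) = ENNReal.ofReal A * volume (R.upper p γ) := by
    rw [← hw.weightMeasure_lower p hγ R, weightMeasure, withDensity_congr_ae hf]
  rw [← hup] at hs ⊢
  rw [← hlow, hμ]
  -- Otherwise `{f ≤ s}` lies in the sublevel set almost everywhere, and the two exceptional
  -- fractions `1 - α` and less than `α` would have to cover the whole window.
  have hAs : ENNReal.ofReal (β * A) ≤ s := by
    by_contra! hlt
    have h1 : volume (R.upper p γ) ≤ volume (R.upper p γ ∩ {z | s < f z}) +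
        volume (R.upper p γ ∩ {z | w z < β * A}) := by
      refine le_trans (measure_mono_ae ?_) (measure_union_le _ _)
      filter_upwards [hf] with z hz hzU
      rcases lt_or_ge s (f z) with h2 | h2
      · exact Or.inl ⟨hzU, h2⟩
      · refine Or.inr ⟨hzU, ?_⟩
        rw [← hz] at h2
        exact lt_of_not_ge fun h3 =>
          absurd (h2.trans_lt hlt) (not_lt.2 (ENNReal.ofReal_le_ofReal h3))
    have h3 : volume (R.upper p γ) < ENNReal.ofReal (1 - α) * volume (R.upper p γ) +
        ENNReal.ofReal α * volume (R.upper p γ) :=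
      h1.trans_lt (ENNReal.add_lt_add_of_le_of_lt
        (ne_top_of_le_ne_top hVtop (measure_mono inter_subset_left)) hs (h R))
    rw [← add_mul, ← ENNReal.ofReal_add (by linarith) hα0.le, sub_add_cancel, ENNReal.ofReal_one,
      one_mul] at h3
    exact lt_irrefl _ h3
  calc ENNReal.ofReal A * volume (R.upper p γ)
      = ENNReal.ofReal β⁻¹ * ENNReal.ofReal (β * A) * volume (R.upper p γ) := by
        rw [← ENNReal.ofReal_mul (by positivity), inv_mul_cancel_left₀ hβ.ne']
    _ ≤ _ := by gcongr

/-- With `q = 1 + 1 / σ` the dual exponent is `-σ`. The bound `C * A ^ (-σ)` for the dual average,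
raised to the power `q - 1 = 1 / σ`, cancels the factor `A`; a rectangle with `A = 0` contributes
zero. -/
theorem exists_memMuckenhoupt (hw : IsWeight w) {p γ α β : ℝ} (hp : 1 < p) (hγ0 : 0 < γ)
    (hγ : γ < 1) (hα0 : 0 < α) (hα : α < 1) (hβ : 0 < β)
    (h : ∀ R : ParabolicRectangle n,
      volume (R.upper p γ ∩ {z | w z < β * ⨍ y in R.lower p γ, w y}) <
        ENNReal.ofReal α * volume (R.upper p γ)) :
    ∃ q : ℝ, 1 < q ∧ MemMuckenhoupt p γ q w := by
  have hfm : AEMeasurable fun z => ENNReal.ofReal (w z) := hw.aemeasurable.ennreal_ofReal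
  set f := hfm.mk _ with hfdef
  have hf : Measurable f := hfm.measurable_mk
  have hwf : (fun z => ENNReal.ofReal (w z)) =ᵐ[volume] f := hfm.ae_eq_mk
  have hctl := hw.pastControl hγ hα0 hα hβ h hwf
  obtain ⟨e, ρ, M, he0, he1, hρ0, hρ1, hM, hdecay⟩ :=
    PastControl.exists_decay n hp hγ0 hγ (sub_pos.2 hα) (ENNReal.ofReal_ne_top (r := β⁻¹))
  obtain ⟨σ, hσ, C, hC, hbound⟩ :=
    exists_lintegral_rpow_neg_le (X := (Fin n → ℝ) × ℝ) he0 he1 hρ0 hρ1 hM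
  refine ⟨1 + 1 / σ, by simpa using hσ, hw, ?_⟩
  have hexp : 1 / (1 - (1 + 1 / σ)) = -σ := by field_simp; ring
  refine lt_of_le_of_lt (iSup_le fun R => ?_ : _ ≤ C ^ (1 / σ))
    (ENNReal.rpow_lt_top_of_nonneg (by positivity) hC)
  set A := ENNReal.ofReal (⨍ y in R.lower p γ, w y) with hA
  set V := volume (R.upper p γ) with hV
  have hV0 : V ≠ 0 := R.volume_upper_ne_zero p hγ
  have hVtop : V ≠ ∞ := R.volume_upper_ne_top p γ
  have hAV : ∫⁻ z in R.lower p γ, ENNReal.ofReal (w z) = A * V := by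
    rw [← withDensity_apply', ← hw.weightMeasure_lower p hγ R, weightMeasure]
  rw [hexp, add_sub_cancel_left, setLAverage_eq, setLAverage_eq, R.volume_lower_eq, hAV,
    ENNReal.mul_div_cancel_right hV0 hVtop]
  rcases eq_or_ne A 0 with h0 | hA0
  · rw [h0, zero_mul]; exact zero_le
  have hint : ∫⁻ z in R.upper p γ, ENNReal.ofReal (w z) ^ (-σ) ≤ C * A ^ (-σ) * V := by
    have h1 : ∫⁻ z in R.upper p γ, ENNReal.ofReal (w z) ^ (-σ) =
        ∫⁻ z in R.upper p γ, f z ^ (-σ) :=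
      lintegral_congr_ae (ae_restrict_of_ae (hwf.mono fun z hz => by simp only [hz]))
    rw [h1]
    refine hbound (volume.restrict (R.upper p γ)) f hf A V hA0 ENNReal.ofReal_ne_top
      (by rw [Measure.restrict_apply_univ]) fun k => ?_
    rw [Measure.restrict_apply' (R.measurableSet_upper p γ), inter_comm, hV, R.upper_eq_window]
    refine hdecay f hf hctl R.x R.t R.L R.L_pos A hA0 ENNReal.ofReal_ne_top ?_ k
    rw [← R.lower_eq_window, R.volume_lower_eq, ← hw.weightMeasure_lower p hγ R, weightMeasure,
      withDensity_congr_ae hwf]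
  have hAtop : A ≠ ∞ := ENNReal.ofReal_ne_top
  calc A * ((∫⁻ z in R.upper p γ, ENNReal.ofReal (w z) ^ (-σ)) / V) ^ (1 / σ)
      ≤ A * (C * A ^ (-σ)) ^ (1 / σ) := by
        gcongr
        exact ENNReal.div_le_of_le_mul hint
    _ = C ^ (1 / σ) * (A * A ^ (-1 : ℝ)) := by
        rw [ENNReal.mul_rpow_of_nonneg _ _ (by positivity), ← ENNReal.rpow_mul,
          show -σ * (1 / σ) = -1 by field_simp]
        ring
    _ = C ^ (1 / σ) := by
        rw [ENNReal.rpow_neg_one, ENNReal.mul_inv_cancel hA0 hAtop, mul_one]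

end IsWeight

/-! ### The equivalences -/

theorem mainTheorem1 (n : ℕ) (hn : 1 ≤ n) (p γ : ℝ) (hp : 1 < p) (hγ0 : 0 < γ) (hγ1 : γ < 1)
    (w : (Fin n → ℝ) × ℝ → ℝ) (hw : IsWeight w) :
    List.TFAE [
      -- (i)
      ∃ q : ℝ, 1 < q ∧ MemMuckenhoupt p γ q w,
      -- (ii)
      ∃ K δ : ℝ, 0 < K ∧ 0 < δ ∧ ∀ R : ParabolicRectangle n,
        weightMeasure w (R.lower p γ) ≠ 0 →
        ∀ E : Set ((Fin n → ℝ) × ℝ), MeasurableSet E → E ⊆ R.upper p γ →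
          volume E / volume (R.upper p γ) ≤
            ENNReal.ofReal K * (weightMeasure w E / weightMeasure w (R.lower p γ)) ^ δ,
      -- (iii)
      ∀ α : ℝ, 0 < α → α < 1 → ∃ β : ℝ, 0 < β ∧ β < 1 ∧ ∀ R : ParabolicRectangle n,
        ∀ E : Set ((Fin n → ℝ) × ℝ), MeasurableSet E → E ⊆ R.upper p γ →
          weightMeasure w E < ENNReal.ofReal β * weightMeasure w (R.lower p γ) →
          volume E < ENNReal.ofReal α * volume (R.upper p γ),
      -- (iv)
      ∃ α β : ℝ, 0 < α ∧ α < 1 ∧ 0 < β ∧ β < 1 ∧ ∀ R : ParabolicRectangle n,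
        ∀ E : Set ((Fin n → ℝ) × ℝ), MeasurableSet E → E ⊆ R.upper p γ →
          weightMeasure w E < ENNReal.ofReal β * weightMeasure w (R.lower p γ) →
          volume E < ENNReal.ofReal α * volume (R.upper p γ),
      -- (v)
      ∃ α β : ℝ, 0 < α ∧ α < 1 ∧ 0 < β ∧ β < 1 ∧ ∀ R : ParabolicRectangle n,
        volume (R.upper p γ ∩ {z | w z < β * ⨍ y in R.lower p γ, w y}) <
          ENNReal.ofReal α * volume (R.upper p γ),
      -- (vi)
      ∃ ε : ℝ, 0 < ε ∧ ε < 1 ∧ ∀ R : ParabolicRectangle n,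
        ⨍ z in R.upper p γ, (w z - ⨍ y in R.lower p γ, w y)⁻ ≤
          ε * ⨍ y in R.lower p γ, w y] := by
  tfae_have 1 → 2 := by
    rintro ⟨q, hq, -, hA⟩
    exact hw.exists_volume_le_of_muckenhoupt hγ1 hq hA
  tfae_have 2 → 3 := by
    rintro ⟨K, δ, hK, hδ, h⟩ α hα0 hα1
    -- Solves `K * b ^ δ = α / 2`, leaving room for a strict inequality.
    set b : ℝ := (α / (2 * K)) ^ (1 / δ) with hb
    have hb0 : 0 < b := by positivity
    refine ⟨min (1 / 2) b, lt_min (by norm_num) hb0,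
      (min_le_left _ _).trans_lt (by norm_num), fun R E hE hEU hlt => ?_⟩
    have hV0 := R.volume_upper_ne_zero p hγ1
    have hVtop := R.volume_upper_ne_top p γ
    have hR : weightMeasure w (R.lower p γ) ≠ 0 := by
      intro h0
      rw [h0, mul_zero] at hlt
      exact absurd hlt not_lt_zero
    have hratio : weightMeasure w E / weightMeasure w (R.lower p γ) ≤ ENNReal.ofReal b :=
      ENNReal.div_le_of_le_mul (hlt.le.trans (by gcongr; exact min_le_right _ _))
    have h1 : volume E / volume (R.upper p γ) < ENNReal.ofReal α :=
      calc _ ≤ ENNReal.ofReal K * ENNReal.ofReal b ^ δ :=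
            (h R hR E hE hEU).trans (by gcongr)
        _ = ENNReal.ofReal (α / 2) := by
            rw [ENNReal.ofReal_rpow_of_pos hb0, ← ENNReal.ofReal_mul hK.le, hb,
              ← Real.rpow_mul (by positivity), one_div_mul_cancel hδ.ne', Real.rpow_one]
            congr 1
            field_simp
        _ < ENNReal.ofReal α := (ENNReal.ofReal_lt_ofReal_iff hα0).2 (by linarith)
    exact (ENNReal.div_lt_iff (Or.inl hV0) (Or.inl hVtop)).1 h1
  tfae_have 3 → 4 := by
    intro h
    obtain ⟨β, hβ0, hβ1, hβ⟩ := h (1 / 2) (by norm_num) (by norm_num)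
    exact ⟨1 / 2, β, by norm_num, by norm_num, hβ0, hβ1, hβ⟩
  tfae_have 4 → 5 := by
    rintro ⟨α, β, hα0, hα1, hβ0, hβ1, h⟩
    exact ⟨α, β, hα0, hα1, hβ0, hβ1, fun R => hw.volume_sublevel_lt hγ1 hα0 hβ0 R (h R)⟩
  tfae_have 5 → 6 := by
    rintro ⟨α, β, hα0, hα1, hβ0, hβ1, h⟩
    refine ⟨1 - β * (1 - α), ?_, ?_, fun R =>
      hw.average_negPart_le hγ1 hα0 hβ0 hβ1 R (h R)⟩
    · nlinarith
    · nlinarith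
  tfae_have 6 → 5 := by
    rintro ⟨ε, hε0, hε1, h⟩
    have h1 : ε / (1 - (1 - ε) / 2) < (1 + 3 * ε) / (2 * (1 + ε)) := by
      rw [div_lt_div_iff₀ (by linarith) (by linarith)]
      nlinarith
    -- With this β the Chebyshev bound is `ε / (1 - β) = 2 ε / (1 + ε) < 1`, and α is the midpoint
    -- between it and 1.
    refine ⟨(1 + 3 * ε) / (2 * (1 + ε)), (1 - ε) / 2, by positivity, ?_, by linarith,
      by linarith, fun R => ?_⟩
    · rw [div_lt_one (by linarith)]; linarith
    · refine (hw.volume_sublevel_le_of_average_negPart_le hγ1 (by linarith) R (h R)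
        hε0.le).trans_lt ?_
      refine ENNReal.mul_lt_mul_left (R.volume_upper_ne_zero p hγ1) (R.volume_upper_ne_top p γ) ?_
      exact (ENNReal.ofReal_lt_ofReal_iff (by positivity)).2 h1
  tfae_have 5 → 1 := by
    rintro ⟨α, β, hα0, hα1, hβ0, -, h⟩
    exact hw.exists_memMuckenhoupt hp hγ0 hγ1 hα0 hα1 hβ0 h
  tfae_finish
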